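/- Distributions are over $[n]=\{1,\dots,n\}$, and $d_{TV}(D,D')=\frac12\sum_i|D(i)-D'(i)|$. A distribution $D$ is monotone if $D(1)\ge D(2)\ge\dots\ge D(n)$, and it is $\delta$-far from monotone if $d_{TV}(D,D')>\delta$ for every monotone distribution $D'$ over $[n]$. A single-pass streaming algorithm with $m$ bits of memory and $S$ samples reads $S$ i.i.d. samples from an unknown distribution $D$ over $[n]$ one at a time, keeps only $m$ bits between consecutive samples, and outputs Accept or Reject as a function of its final memory content; it may be randomized (with random bits not charged to the memory) and its update rule may depend on the position in the stream. It tests monotone versus $\delta$-far from monotone with error $1/3$ if it accepts every monotone $D$ with probability at least $2/3$ and rejects every $D$ that is $\delta$-far from monotone with probability at least $2/3$. **Theorem.** (1) Let $k\ge 3$, $0<\varepsilon\le 1$ and $Y_1,\dots,Y_k\in\{-1,1\}$. Then the distribution $D$ over $[2k]$ given by $$D(2i-1)=\frac{1+Y_i\varepsilon}{2k},\qquad D(2i)=\frac{1-Y_i\varepsilon}{2k}\qquad(1\le i\le k)$$ is $\varepsilon/4$-far from monotone. (2) There is an absolute constant $c>0$ such that for all integers $n\ge 2$, $m,S\ge 0$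 and all $0<\varepsilon\le 1$: if a single-pass streaming algorithm with $m$ bits of memory and $S$ samples tests monotone versus $\varepsilon/4$-far from monotone, for distributions over $[n]$, with error $1/3$, then $$S\cdot m\ \ge\ c\,\frac{n}{\varepsilon^2}.$$ If moreover $\dfrac{n^{0.34}}{\varepsilon^{8/3}}+\dfrac{n^{0.1}}{\varepsilon^4}\le m\le\dfrac{\sqrt n}{\varepsilon^3}$, then $$S\cdot m\ \ge\ c\,\frac{n\log n}{\varepsilon^4}.$$ -/

import Mathlib

/-- The content of a memory of `m` bits. -/
abbrev Memory (m : ℕ) : Type := Fin m → Bool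

/-- A deterministic single-pass streaming algorithm that reads a stream of `S` elements of an
`n`-element domain, one at a time, and keeps `m` bits of memory between two consecutive elements.
The update rule may depend on the position in the stream, so a clock is not charged to the memory,
and no bound is put on the cost of computing an update. The output `true` means "accept". -/
structure DetStreamingAlgorithm (n m S : ℕ) where
  /-- the initial content of the memory -/
  init : Memory m
  /-- the new content of the memory after the `t`-th stream element -/
  step : Fin S → Memory m → Fin n → Memory m
  /-- the verdict, a function of the final content of the memory only -/
  verdict : Memory m → Bool

namespace DetStreamingAlgorithm

variable {n m S : ℕ}

/-- The content of the memory after the whole stream has been read. -/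
def finalMemory (A : DetStreamingAlgorithm n m S) (x : Fin S → Fin n) : Memory m :=
  Fin.foldl S (fun s t => A.step t s (x t)) A.init

/-- The verdict on the stream `x`. -/
def run (A : DetStreamingAlgorithm n m S) (x : Fin S → Fin n) : Bool :=
  A.verdict (A.finalMemory x)

end DetStreamingAlgorithm

/-- A randomized single-pass streaming algorithm is a probability distribution over deterministic
ones. As there are finitely many of these, every use of randomness (a random string that is fixed
in advance and not charged to the memory, or fresh coins at each step) is of this form. -/
abbrev StreamingAlgorithm (n m S : ℕ) : Type := PMF (DetStreamingAlgorithm n m S)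

/-- The law of a stream of `S` independent samples from `D`. -/
noncomputable def iidStream {n : ℕ} (D : PMF (Fin n)) (S : ℕ) : PMF (Fin S → Fin n) :=
  PMF.ofFintype (fun x => ∏ t, D (x t)) (by
    have h := Finset.prod_univ_sum (fun _ : Fin S => (Finset.univ : Finset (Fin n)))
      (fun _ i => D i)
    rw [Fintype.piFinset_univ] at h
    rw [← h]
    have h1 : ∑ i, D i = 1 := (tsum_fintype _).symm.trans D.tsum_coe
    simp [h1])

/-- The law of the verdict of a randomized algorithm on a stream of independent samples from `D`
(independent of the random choices of the algorithm as well). -/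
noncomputable def StreamingAlgorithm.outputLaw {n m S : ℕ} (A : StreamingAlgorithm n m S)
    (D : PMF (Fin n)) : PMF Bool :=
  A.bind fun a => (iidStream D S).map a.run

/-- Total variation distance of two distributions on an `n`-element domain. -/
noncomputable def tvDist {n : ℕ} (D D' : PMF (Fin n)) : ℝ :=
  (1 / 2) * ∑ i, |(D i).toReal - (D' i).toReal|

/-- A distribution is monotone if its probabilities are non-increasing. -/
def IsMonotoneDist {n : ℕ} (D : PMF (Fin n)) : Prop :=
  ∀ i j : Fin n, i ≤ j → D j ≤ D i

/-- `D` is `δ`-far from monotone: every monotone distribution is at distance more than `δ`. -/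
def FarFromMonotone {n : ℕ} (δ : ℝ) (D : PMF (Fin n)) : Prop :=
  ∀ D' : PMF (Fin n), IsMonotoneDist D' → δ < tvDist D D'

/-- `A` tests monotone versus `δ`-far from monotone with error probability at most `1/3`. -/
def TestsMonotonicity {n m S : ℕ} (A : StreamingAlgorithm n m S) (δ : ℝ) : Prop :=
  (∀ D : PMF (Fin n), IsMonotoneDist D → 2 / 3 ≤ A.outputLaw D true) ∧
  (∀ D : PMF (Fin n), FarFromMonotone δ D → 2 / 3 ≤ A.outputLaw D false)

/-- The weights of the paired `±ε` perturbation of the uniform distribution on `2 * k` points with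
signs `Y`: counting from `0`, the points `2 * j` and `2 * j + 1` form the `j`-th pair and have the
weights `(1 + Y j * ε) / (2 * k)` and `(1 - Y j * ε) / (2 * k)`. -/
noncomputable def pairedWeight {k : ℕ} (ε : ℝ) (Y : Fin k → ℤˣ) (i : Fin (2 * k)) : ℝ :=
  (1 + (-1) ^ (i : ℕ) * ((Y ⟨(i : ℕ) / 2, by omega⟩ : ℤ) : ℝ) * ε) / (2 * k)

theorem pairedWeight_nonneg {k : ℕ} {ε : ℝ} (h0 : 0 ≤ ε) (h1 : ε ≤ 1) (Y : Fin k → ℤˣ)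
    (i : Fin (2 * k)) : 0 ≤ pairedWeight ε Y i := by
  unfold pairedWeight
  apply div_nonneg _ (by positivity)
  rcases neg_one_pow_eq_or ℝ (i : ℕ) with h | h <;>
  rcases Int.units_eq_one_or (Y ⟨(i : ℕ) / 2, by omega⟩) with h' | h' <;>
  rw [h, h'] <;> push_cast <;> linarith

theorem sum_pairedWeight {k : ℕ} (hk : 0 < k) (ε : ℝ) (Y : Fin k → ℤˣ) :
    ∑ i, pairedWeight ε Y i = 1 := by
  have hk' : (k : ℝ) ≠ 0 := by positivity
  rw [← (finProdFinEquiv.trans (finCongr (Nat.mul_comm k 2))).sum_comp, Fintype.sum_prod_type]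
  have h : ∀ j : Fin k, ∑ b : Fin 2, pairedWeight ε Y
      ((finProdFinEquiv.trans (finCongr (Nat.mul_comm k 2))) (j, b)) = 1 / k := by
    intro j
    have e0 : (2 * (j : ℕ)) / 2 = j := by omega
    have e1 : (1 + 2 * (j : ℕ)) / 2 = j := by omega
    simp only [Fin.sum_univ_two, pairedWeight, Equiv.trans_apply, finCongr_apply, Fin.val_cast,
      finProdFinEquiv_apply_val, Fin.val_zero, Fin.val_one, zero_add, e0, e1, pow_add, pow_mul,
      Fin.eta]
    field_simp
    ring
  simp only [h]
  simp [hk']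

/-- The paired `±ε` perturbation of the uniform distribution with signs `Y`. -/
noncomputable def pairedPerturbation {k : ℕ} (hk : 0 < k) {ε : ℝ} (h0 : 0 ≤ ε) (h1 : ε ≤ 1)
    (Y : Fin k → ℤˣ) : PMF (Fin (2 * k)) :=
  PMF.ofFintype (fun i => ENNReal.ofReal (pairedWeight ε Y i)) (by
    rw [← ENNReal.ofReal_sum_of_nonneg fun i _ => pairedWeight_nonneg h0 h1 Y i,
      sum_pairedWeight hk, ENNReal.ofReal_one])

/-! Draw the signs `Y` at random and compare the memory under the resulting mixture of paired
perturbations with the memory under the uniform distribution on the pairs, which is monotone. A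
tester must tell the two apart, so by a Pinsker-type bound (`sq_sub_le_four_mul_kl`) the relative
entropy of the final memory is at least `1/36`.

The entropy grows slowly. Given `Y`, a fresh sample is independent of the memory and its law is
affine in the signs, so jointly with the memory it sees only the conditional mean of the sign
vector. By data processing, one sample adds at most `ε² / k` times the mean squared norm of that
conditional mean, the energy (`stateKL_step`). Hence `S * (ε² / k) * E ≥ 1/36` whenever `E` bounds
the energies.

Energy is bounded by an entropy argument (`sum_sq_condMean_le`): a statistic with `|M|` values
cannot have conditional means of a subgaussian vector larger than about `log |M|` in mean square.
Applied to the signs themselves, this gives energy `O(m)` and the bound `n / ε²`.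

For the logarithmic bound, the vector is instead the posterior mean of the signs given the whole
stream. A pair hit `r` times has posterior mean at most `ε * r`, and zero if it is not hit. If the
stream has at most about `n ^ 0.9 * log n` samples, loads above `20` are negligible, and sign
symmetry makes the truncated posterior subgaussian at scale `θ` of order `log n / ε²`
(`sum_mixtureWeight_mul_exp_le`); the energy drops to `O(ε² * m / log n)`. For longer streams the
lower bound on `m` already gives the claimed product.

Far from monotone: a monotone sequence has telescoping drops, so it cannot descend by `ε / k` in
many pairs while remaining near `1 / (2k)` on them. -/

/-! ### Entropy inequalities. -/

/-- This is `1 - 1/x ≤ log x` at `x = (a / b) / c`, with equality at `c = a / b`; it linearises the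
relative entropy around a prescribed ratio `c`. -/
theorem mul_log_div_ge {a b c : ℝ} (ha : 0 ≤ a) (hb : 0 ≤ b) (hab : b = 0 → a = 0) (hc : 0 < c) :
    a * Real.log c + a - c * b ≤ a * Real.log (a / b) := by
  rcases ha.eq_or_lt with rfl | ha
  · simp only [zero_mul, zero_add, zero_sub, Left.neg_nonpos_iff]
    positivity
  have hb : 0 < b := hb.lt_of_ne fun h => ha.ne' (hab h.symm)
  have h := Real.one_sub_inv_le_log_of_pos (x := a / b / c) (by positivity)
  rw [Real.log_div (by positivity) hc.ne'] at h
  have h2 := mul_le_mul_of_nonneg_left h ha.le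
  have e : a * (1 - (a / b / c)⁻¹) = a - c * b := by field_simp
  rw [e] at h2
  linarith

/-- Data processing: relative entropy does not increase under a deterministic map. -/
theorem sum_mul_log_div_map_le {α β : Type*} [Fintype α] [Fintype β] [DecidableEq β]
    (φ : α → β) (a b : α → ℝ) (ha : ∀ x, 0 ≤ a x) (hb : ∀ x, 0 ≤ b x)
    (hab : ∀ x, b x = 0 → a x = 0) :
    ∑ y, (∑ x with φ x = y, a x) * Real.log ((∑ x with φ x = y, a x) / ∑ x with φ x = y, b x) ≤
      ∑ x, a x * Real.log (a x / b x) := by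
  rw [← Finset.sum_fiberwise Finset.univ φ (fun x => a x * Real.log (a x / b x))]
  refine Finset.sum_le_sum fun y _ => ?_
  set A := ∑ x with φ x = y, a x with hA
  set B := ∑ x with φ x = y, b x with hB
  have hA0 : 0 ≤ A := Finset.sum_nonneg fun x _ => ha x
  have hB0 : 0 ≤ B := Finset.sum_nonneg fun x _ => hb x
  rcases hA0.eq_or_lt with h0 | hpos
  · have h1 : ∀ x ∈ Finset.univ.filter (fun x => φ x = y), a x = 0 :=
      (Finset.sum_eq_zero_iff_of_nonneg fun x _ => ha x).1 h0.symm
    rw [← h0, zero_mul]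
    exact (Finset.sum_eq_zero fun x hx => by rw [h1 x hx, zero_mul]).ge
  have hBpos : 0 < B := by
    refine hB0.lt_of_ne fun h => hpos.ne' ?_
    have h1 := (Finset.sum_eq_zero_iff_of_nonneg fun x _ => hb x).1 h.symm
    exact Finset.sum_eq_zero fun x hx => hab x (h1 x hx)
  -- With the ratio `A / B` of the whole fibre as slope, the linear corrections cancel in the sum.
  calc A * Real.log (A / B) = ∑ x with φ x = y, (a x * Real.log (A / B) + a x - A / B * b x) := by
        rw [Finset.sum_sub_distrib, Finset.sum_add_distrib, ← Finset.sum_mul, ← Finset.mul_sum,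
          ← hA, ← hB]
        field_simp
        ring
    _ ≤ _ := Finset.sum_le_sum fun x _ =>
        mul_log_div_ge (ha x) (hb x) (hab x) (by positivity)

/-- A weak form of Pinsker's inequality, through the Hellinger distance. -/
theorem sq_sub_le_four_mul_kl {M : Type*} [Fintype M] (p q : M → ℝ) (hp : ∀ x, 0 ≤ p x)
    (hq : ∀ x, 0 ≤ q x) (hpq : ∀ x, p x = 0 → q x = 0) (hp1 : ∑ x, p x = 1) (hq1 : ∑ x, q x = 1)
    (V : Finset M) :
    (∑ x ∈ V, p x - ∑ x ∈ V, q x) ^ 2 ≤ 4 * ∑ x, q x * Real.log (q x / p x) := by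
  -- The squared Hellinger distance is below the relative entropy: `1 - 1/y ≤ log y` at `y = √q /
  -- √p`.
  have h1 : ∑ x, (√(p x) - √(q x)) ^ 2 ≤ ∑ x, q x * Real.log (q x / p x) := by
    have h : ∀ x, (√(p x) - √(q x)) ^ 2 + q x - p x ≤ q x * Real.log (q x / p x) := by
      intro x
      have sp := Real.sq_sqrt (hp x)
      have sq := Real.sq_sqrt (hq x)
      rcases (hq x).eq_or_lt with h0 | hpos
      · rw [← h0]; simp [sp]
      have hppos : 0 < p x := (hp x).lt_of_ne fun h => hpos.ne' (hpq x h.symm)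
      have h := Real.one_sub_inv_le_log_of_pos (x := √(q x) / √(p x)) (by positivity)
      have hl : Real.log (q x / p x) = 2 * Real.log (√(q x) / √(p x)) := by
        rw [← Real.sqrt_div (hq x), Real.log_sqrt (by positivity)]
        ring
      rw [hl]
      have h2 := mul_le_mul_of_nonneg_left h (by positivity : 0 ≤ 2 * q x)
      have e : 2 * q x * (1 - (√(q x) / √(p x))⁻¹) = 2 * q x - 2 * (√(q x) * √(p x)) := by
        nth_rewrite 1 [← sq]
        have : √(q x) ≠ 0 := (Real.sqrt_pos.2 hpos).ne'
        field_simp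
        rw [mul_sub, ← pow_two, sq]
      rw [e] at h2
      nlinarith
    have := Finset.sum_le_sum fun x (_ : x ∈ Finset.univ) => h x
    rw [Finset.sum_sub_distrib, Finset.sum_add_distrib, hp1, hq1] at this
    linarith
  have h2 : ∑ x, (√(p x) + √(q x)) ^ 2 ≤ 4 := by
    have h : ∀ x, (√(p x) + √(q x)) ^ 2 ≤ 2 * p x + 2 * q x := by
      intro x
      nlinarith [Real.sq_sqrt (hp x), Real.sq_sqrt (hq x), sq_nonneg (√(p x) - √(q x))]
    have := Finset.sum_le_sum fun x (_ : x ∈ Finset.univ) => h x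
    rw [Finset.sum_add_distrib, ← Finset.mul_sum, ← Finset.mul_sum, hp1, hq1] at this
    linarith
  -- Factoring the difference through square roots prepares Cauchy–Schwarz; the factor `4` is the
  -- bound on the sum of `(√p + √q)²`.
  have e : ∑ x ∈ V, p x - ∑ x ∈ V, q x
      = ∑ x ∈ V, (√(p x) + √(q x)) * (√(p x) - √(q x)) := by
    rw [← Finset.sum_sub_distrib]
    refine Finset.sum_congr rfl fun x _ => ?_
    nlinarith [Real.sq_sqrt (hp x), Real.sq_sqrt (hq x)]
  rw [e]
  refine (Finset.sum_mul_sq_le_sq_mul_sq _ _ _).trans ?_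
  have m1 : ∑ x ∈ V, (√(p x) + √(q x)) ^ 2 ≤ ∑ x, (√(p x) + √(q x)) ^ 2 :=
    Finset.sum_le_sum_of_subset_of_nonneg (Finset.subset_univ _) fun _ _ _ => sq_nonneg _
  have m2 : ∑ x ∈ V, (√(p x) - √(q x)) ^ 2 ≤ ∑ x, (√(p x) - √(q x)) ^ 2 :=
    Finset.sum_le_sum_of_subset_of_nonneg (Finset.subset_univ _) fun _ _ _ => sq_nonneg _
  exact mul_le_mul (m1.trans h2) (m2.trans h1) (Finset.sum_nonneg fun _ _ => sq_nonneg _)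
    (by norm_num)

/-- If the exponential moments of a bounded random vector `U` are subgaussian in the range of its
conditional means, then a function with values in `M` cannot be strongly correlated with `U`. -/
theorem sum_sq_condMean_le {Z M ι : Type*} [Fintype Z] [Fintype M] [Nonempty M] [DecidableEq M]
    [Fintype ι] (P : Z → ℝ) (hP : ∀ z, 0 ≤ P z) (hP1 : ∑ z, P z = 1) (F : Z → M)
    (U : Z → ι → ℝ) {θ b : ℝ} (hθ : 0 < θ) (hb : 0 ≤ b) (hU : ∀ z i, |U z i| ≤ b)
    (hmgf : ∀ a : ι → ℝ, (∀ i, |a i| ≤ b) →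
      ∑ z, P z * Real.exp (θ * ∑ i, a i * U z i) ≤ Real.exp (θ / 2 * ∑ i, a i ^ 2)) :
    ∑ μ, ∑ i, (∑ z with F z = μ, P z * U z i) ^ 2 / (∑ z with F z = μ, P z) ≤
      2 / θ * Real.log (Fintype.card M) := by
  set q : M → ℝ := fun μ => ∑ z with F z = μ, P z with hq
  set c : M → ι → ℝ := fun μ i => ∑ z with F z = μ, P z * U z i with hc
  set v : M → ι → ℝ := fun μ i => c μ i / q μ with hv
  have hq0 : ∀ μ, 0 ≤ q μ := fun μ => Finset.sum_nonneg fun z _ => hP z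
  have hcb : ∀ μ i, |c μ i| ≤ b * q μ := by
    intro μ i
    refine (Finset.abs_sum_le_sum_abs _ _).trans ?_
    rw [hq, Finset.mul_sum]
    refine Finset.sum_le_sum fun z _ => ?_
    rw [abs_mul, abs_of_nonneg (hP z), mul_comm]
    exact mul_le_mul_of_nonneg_right (hU z i) (hP z)
  -- On a null state the quotient defaults to `0`, which is harmless because `c` vanishes there too.
  have hcv : ∀ μ i, c μ i = q μ * v μ i := by
    intro μ i
    by_cases h : q μ = 0
    · have := hcb μ i
      rw [h, mul_zero] at this
      rw [abs_nonpos_iff.1 this, h, zero_mul]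
    · simp only [hv]; field_simp
  have hvb : ∀ μ i, |v μ i| ≤ b := by
    intro μ i
    rw [hv]
    simp only [abs_div, abs_of_nonneg (hq0 μ)]
    exact div_le_of_le_mul₀ (hq0 μ) hb (hcb μ i)
  set x : M → ℝ := fun μ => θ / 2 * ∑ i, v μ i ^ 2 with hx
  -- Conditional Jensen with the direction `a = v μ`: on the fibre the exponent has mean `2 * x μ`,
  -- while the full moment is at most `exp (x μ)`. One factor `exp (x μ)` cancels.
  have hqx : ∀ μ, q μ * Real.exp (x μ) ≤ 1 := by
    intro μ
    have h1 : q μ * Real.exp (2 * x μ) ≤ ∑ z, P z * Real.exp (θ * ∑ i, v μ i * U z i) := by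
      calc q μ * Real.exp (2 * x μ)
          = ∑ z with F z = μ, P z *
              -- The tangent line of `exp` at `2 * x μ`; its linear part sums to zero over the
              -- fibre.
              (Real.exp (2 * x μ) * (1 + (θ * ∑ i, v μ i * U z i - 2 * x μ))) := by
            have e : ∀ z, P z * (Real.exp (2 * x μ) * (1 + (θ * ∑ i, v μ i * U z i - 2 * x μ)))
                = Real.exp (2 * x μ) * (P z * (1 - 2 * x μ)
                  + θ * ∑ i, v μ i * (P z * U z i)) := by
              intro z
              have : ∑ i, v μ i * (P z * U z i) = P z * ∑ i, v μ i * U z i := by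
                rw [Finset.mul_sum]; exact Finset.sum_congr rfl fun i _ => by ring
              rw [this]; ring
            rw [Finset.sum_congr rfl fun z _ => e z, ← Finset.mul_sum, Finset.sum_add_distrib,
              ← Finset.sum_mul, ← Finset.mul_sum, Finset.sum_comm]
            simp_rw [← Finset.mul_sum]
            have : ∑ i, v μ i * ∑ z with F z = μ, P z * U z i = q μ * ∑ i, v μ i ^ 2 := by
              rw [Finset.mul_sum]
              refine Finset.sum_congr rfl fun i _ => ?_
              have := hcv μ i
              simp only [hc] at this
              rw [this]; ring
            rw [this, hx]
            ring
        _ ≤ ∑ z with F z = μ, P z * Real.exp (θ * ∑ i, v μ i * U z i) := by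
            refine Finset.sum_le_sum fun z _ => mul_le_mul_of_nonneg_left ?_ (hP z)
            have h := Real.add_one_le_exp (θ * ∑ i, v μ i * U z i - 2 * x μ)
            calc _ ≤ Real.exp (2 * x μ) * Real.exp (θ * ∑ i, v μ i * U z i - 2 * x μ) :=
                  mul_le_mul_of_nonneg_left (by linarith) (Real.exp_pos _).le
              _ = _ := by rw [← Real.exp_add]; congr 1; ring
        _ ≤ _ := Finset.sum_le_sum_of_subset_of_nonneg (Finset.subset_univ _)
            fun z _ _ => mul_nonneg (hP z) (Real.exp_pos _).le
    have h2 := h1.trans (hmgf (v μ) (hvb μ))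
    rw [two_mul, Real.exp_add, ← mul_assoc] at h2
    exact le_of_mul_le_mul_right (by linarith) (Real.exp_pos (x μ))
  have hN : (0 : ℝ) < Fintype.card M := by exact_mod_cast Fintype.card_pos
  have hq1 : ∑ μ, q μ = 1 := by
    rw [← hP1]; exact Finset.sum_fiberwise Finset.univ F P
  -- Since `q * exp x ≤ 1`, the sum of `q * x` is at most the entropy of `q`, hence at most `log
  -- |M|`; this is the termwise Gibbs inequality against the uniform law on `M`.
  have hterm : ∀ μ, q μ * x μ ≤ q μ * Real.log (Fintype.card M) + (1 / Fintype.card M - q μ) := by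
    intro μ
    have h := Real.add_one_le_exp (x μ - Real.log (Fintype.card M))
    rw [Real.exp_sub, Real.exp_log hN] at h
    have h3 := mul_le_mul_of_nonneg_left h (hq0 μ)
    rw [← mul_div_assoc] at h3
    have h4 := h3.trans (div_le_div_of_nonneg_right (hqx μ) hN.le)
    linarith
  have hsum := Finset.sum_le_sum fun μ (_ : μ ∈ Finset.univ) => hterm μ
  rw [Finset.sum_add_distrib, ← Finset.sum_mul, Finset.sum_sub_distrib, hq1, Finset.sum_const,
    Finset.card_univ, nsmul_eq_mul, mul_one_div_cancel hN.ne'] at hsum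
  have hlhs : ∑ μ, ∑ i, c μ i ^ 2 / q μ = 2 / θ * ∑ μ, q μ * x μ := by
    rw [Finset.mul_sum]
    refine Finset.sum_congr rfl fun μ _ => ?_
    rw [hx]
    simp only
    have : 2 / θ * (q μ * (θ / 2 * ∑ i, v μ i ^ 2)) = ∑ i, q μ * v μ i ^ 2 := by
      rw [← Finset.mul_sum]; field_simp
    rw [this]
    refine Finset.sum_congr rfl fun i _ => ?_
    rw [hcv]
    by_cases h : q μ = 0
    · simp [h]
    · field_simp
  rw [hlhs]
  exact mul_le_mul_of_nonneg_left (by linarith) (by positivity)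

/-! ### Signs and likelihoods of streams of signed pairs. -/

/-- A sign as a real number. -/
def sgn (σ : ℤˣ) : ℝ := ((σ : ℤ) : ℝ)

@[simp] theorem sgn_one : sgn 1 = 1 := by simp [sgn]

@[simp] theorem sgn_neg (σ : ℤˣ) : sgn (-σ) = -sgn σ := by simp [sgn]

@[simp] theorem sgn_mul (σ τ : ℤˣ) : sgn (σ * τ) = sgn σ * sgn τ := by simp [sgn]

theorem sgn_eq (σ : ℤˣ) : sgn σ = 1 ∨ sgn σ = -1 := by
  rcases Int.units_eq_one_or σ with rfl | rfl <;> simp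

@[simp] theorem sgn_sq (σ : ℤˣ) : sgn σ ^ 2 = 1 := by rcases sgn_eq σ with h | h <;> rw [h] <;> norm_num

@[simp] theorem abs_sgn (σ : ℤˣ) : |sgn σ| = 1 := by rcases sgn_eq σ with h | h <;> rw [h] <;> norm_num

theorem sum_units (f : ℤˣ → ℝ) : ∑ σ, f σ = f 1 + f (-1) := by
  have : (Finset.univ : Finset ℤˣ) = {1, -1} := by decide
  rw [this, Finset.sum_insert (by decide), Finset.sum_singleton]

/-- The weight of the point `z` of the paired perturbation of the uniform distribution. -/
noncomputable def pairWeight {k : ℕ} (ε : ℝ) (Y : Fin k → ℤˣ) (z : Fin k × ℤˣ) : ℝ :=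
  (1 + ε * sgn z.2 * sgn (Y z.1)) / (2 * k)

/-- The likelihood of a stream of independent samples. -/
noncomputable def streamWeight {k : ℕ} (ε : ℝ) (Y : Fin k → ℤˣ) {t : ℕ}
    (z : Fin t → Fin k × ℤˣ) : ℝ :=
  ∏ j, pairWeight ε Y (z j)

section

variable {k t : ℕ} {ε : ℝ} {Y : Fin k → ℤˣ}

theorem one_add_mul_sgn_nonneg (h0 : 0 ≤ ε) (h1 : ε ≤ 1) (σ τ : ℤˣ) :
    0 ≤ 1 + ε * sgn σ * sgn τ := by
  rcases sgn_eq σ with h | h <;> rcases sgn_eq τ with h' | h' <;> rw [h, h'] <;> linarith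

theorem one_add_mul_sgn_le (h1 : ε ≤ 1) (h0 : 0 ≤ ε) (σ τ : ℤˣ) :
    1 + ε * sgn σ * sgn τ ≤ 2 := by
  rcases sgn_eq σ with h | h <;> rcases sgn_eq τ with h' | h' <;> rw [h, h'] <;> linarith

theorem pairWeight_nonneg (h0 : 0 ≤ ε) (h1 : ε ≤ 1) (z : Fin k × ℤˣ) : 0 ≤ pairWeight ε Y z :=
  div_nonneg (one_add_mul_sgn_nonneg h0 h1 _ _) (by positivity)

/-- The perturbation cancels inside each pair, so the pair index of a sample is uniform whatever `Y`
and `ε` are. -/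
theorem sum_pairWeight_mul (ε : ℝ) (Y : Fin k → ℤˣ) (h : Fin k → ℝ) :
    ∑ z, pairWeight ε Y z * h z.1 = (∑ i, h i) / k := by
  rw [Fintype.sum_prod_type, Finset.sum_div]
  refine Finset.sum_congr rfl fun i _ => ?_
  have hk : (k : ℝ) ≠ 0 := by
    have := i.pos
    positivity
  rw [sum_units]
  simp only [pairWeight, sgn_one, sgn_neg]
  field_simp
  ring

theorem sum_pairWeight (hk : 0 < k) (ε : ℝ) (Y : Fin k → ℤˣ) : ∑ z, pairWeight ε Y z = 1 := by
  have h := sum_pairWeight_mul ε Y fun _ => 1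
  have hk : (k : ℝ) ≠ 0 := by positivity
  simpa [hk] using h

theorem streamWeight_nonneg (h0 : 0 ≤ ε) (h1 : ε ≤ 1) (z : Fin t → Fin k × ℤˣ) :
    0 ≤ streamWeight ε Y z :=
  Finset.prod_nonneg fun _ _ => pairWeight_nonneg h0 h1 _

theorem sum_streamWeight_mul (ε : ℝ) (Y : Fin k → ℤˣ) (t : ℕ) (h : Fin k → ℝ) :
    ∑ z : Fin t → Fin k × ℤˣ, streamWeight ε Y z * ∏ j, h (z j).1 = ((∑ i, h i) / k) ^ t := by
  have e := Finset.prod_univ_sum (fun _ : Fin t => (Finset.univ : Finset (Fin k × ℤˣ)))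
    (fun _ z => pairWeight ε Y z * h z.1)
  rw [Fintype.piFinset_univ] at e
  simp only [streamWeight, ← Finset.prod_mul_distrib, ← e, sum_pairWeight_mul, Finset.prod_const,
    Finset.card_univ, Fintype.card_fin]

theorem sum_streamWeight (hk : 0 < k) (ε : ℝ) (Y : Fin k → ℤˣ) (t : ℕ) :
    ∑ z : Fin t → Fin k × ℤˣ, streamWeight ε Y z = 1 := by
  have h := sum_streamWeight_mul ε Y t fun _ => 1
  have hk : (k : ℝ) ≠ 0 := by positivity
  simpa [hk] using h

/-- A crude likelihood ratio, needed only for absolute continuity; the size of the factor does not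
matter. -/
theorem streamWeight_le (h0 : 0 ≤ ε) (h1 : ε ≤ 1) (z : Fin t → Fin k × ℤˣ) :
    streamWeight ε Y z ≤ 2 ^ t * streamWeight 0 Y z := by
  have : (2 : ℝ) ^ t = ∏ _j : Fin t, 2 := by simp
  rw [streamWeight, streamWeight, this, ← Finset.prod_mul_distrib]
  refine Finset.prod_le_prod (fun _ _ => pairWeight_nonneg h0 h1 _) fun j _ => ?_
  rw [pairWeight, pairWeight, ← mul_div_assoc]
  gcongr
  simpa using one_add_mul_sgn_le h1 h0 _ _

end

/-! ### Growth of the divergence of the memory. -/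

/-- The probability that the samples drive the memory into the state `μ`, for signs drawn with the
weights `w`. -/
noncomputable def stateMass {k t : ℕ} {M : Type*} [DecidableEq M] (ε : ℝ)
    (w : (Fin k → ℤˣ) → ℝ) (F : (Fin t → Fin k × ℤˣ) → M) (μ : M) : ℝ :=
  ∑ Y, ∑ z with F z = μ, w Y * streamWeight ε Y z

/-- The expectation of the `i`-th sign on the event that the memory is in the state `μ`. -/
noncomputable def stateSign {k t : ℕ} {M : Type*} [DecidableEq M] (ε : ℝ)
    (w : (Fin k → ℤˣ) → ℝ) (F : (Fin t → Fin k × ℤˣ) → M) (μ : M) (i : Fin k) : ℝ :=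
  ∑ Y, ∑ z with F z = μ, w Y * streamWeight ε Y z * sgn (Y i)

/-- The mean squared norm of the conditional expectation of the sign vector given the memory. -/
noncomputable def signEnergy {k t : ℕ} {M : Type*} [Fintype M] [DecidableEq M] (ε : ℝ)
    (w : (Fin k → ℤˣ) → ℝ) (F : (Fin t → Fin k × ℤˣ) → M) : ℝ :=
  ∑ μ, ∑ i, stateSign ε w F μ i ^ 2 / stateMass ε w F μ

/-- The divergence of the memory under the mixture of the perturbations from the memory under the
uniform distribution. -/
noncomputable def stateKL {k t : ℕ} {M : Type*} [Fintype M] [DecidableEq M] (ε : ℝ)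
    (w : (Fin k → ℤˣ) → ℝ) (F : (Fin t → Fin k × ℤˣ) → M) : ℝ :=
  ∑ μ, stateMass ε w F μ * Real.log (stateMass ε w F μ / stateMass 0 w F μ)

section

variable {k t : ℕ} {ε : ℝ} {w : (Fin k → ℤˣ) → ℝ} {M : Type*} [DecidableEq M]

theorem stateMass_nonneg (h0 : 0 ≤ ε) (h1 : ε ≤ 1) (hw : ∀ Y, 0 ≤ w Y)
    (F : (Fin t → Fin k × ℤˣ) → M) (μ : M) : 0 ≤ stateMass ε w F μ :=
  Finset.sum_nonneg fun Y _ => Finset.sum_nonneg fun _ _ =>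
    mul_nonneg (hw Y) (streamWeight_nonneg h0 h1 _)

/-- Absolute continuity of the mixture with respect to the uniform case, from the bounded likelihood
ratio. -/
theorem stateMass_eq_zero (h0 : 0 ≤ ε) (h1 : ε ≤ 1) (hw : ∀ Y, 0 ≤ w Y)
    (F : (Fin t → Fin k × ℤˣ) → M) (μ : M) (h : stateMass 0 w F μ = 0) :
    stateMass ε w F μ = 0 := by
  refine le_antisymm ?_ (stateMass_nonneg h0 h1 hw F μ)
  rw [← mul_zero (2 ^ t : ℝ), ← h, stateMass, stateMass, Finset.mul_sum]
  refine Finset.sum_le_sum fun Y _ => ?_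
  rw [Finset.mul_sum]
  refine Finset.sum_le_sum fun z _ => ?_
  rw [mul_left_comm]
  exact mul_le_mul_of_nonneg_left (streamWeight_le h0 h1 z) (hw Y)

theorem abs_stateSign_le (h0 : 0 ≤ ε) (h1 : ε ≤ 1) (hw : ∀ Y, 0 ≤ w Y)
    (F : (Fin t → Fin k × ℤˣ) → M) (μ : M) (i : Fin k) :
    |stateSign ε w F μ i| ≤ stateMass ε w F μ := by
  refine (Finset.abs_sum_le_sum_abs _ _).trans (Finset.sum_le_sum fun Y _ => ?_)
  refine (Finset.abs_sum_le_sum_abs _ _).trans (Finset.sum_le_sum fun z _ => ?_)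
  rw [abs_mul, abs_sgn, mul_one, abs_of_nonneg (mul_nonneg (hw Y) (streamWeight_nonneg h0 h1 _))]

variable [Fintype M]

theorem sum_stateMass (hk : 0 < k) (hw1 : ∑ Y, w Y = 1) (F : (Fin t → Fin k × ℤˣ) → M) :
    ∑ μ, stateMass ε w F μ = 1 := by
  simp only [stateMass]
  rw [Finset.sum_comm, ← hw1]
  refine Finset.sum_congr rfl fun Y _ => ?_
  rw [Finset.sum_fiberwise Finset.univ F (fun z => w Y * streamWeight ε Y z), ← Finset.mul_sum,
    sum_streamWeight hk, mul_one]

/-- One more sample, stored by the update rule `g`. -/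
theorem stateMass_step (ε : ℝ) (w : (Fin k → ℤˣ) → ℝ) (F : (Fin t → Fin k × ℤˣ) → M)
    (g : M → Fin k × ℤˣ → M) (F' : (Fin (t + 1) → Fin k × ℤˣ) → M)
    (hF : ∀ z, F' z = g (F (Fin.init z)) (z (Fin.last t))) (ν : M) :
    stateMass ε w F' ν = ∑ y : M × (Fin k × ℤˣ) with g y.1 y.2 = ν,
      (stateMass ε w F y.1 + ε * sgn y.2.2 * stateSign ε w F y.1 y.2.1) / (2 * k) := by
  -- The summand is the joint law of the old memory and the new sample. Because `pairWeight` is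
  -- affine in the sign, averaging over `Y` leaves only `stateSign`.
  have e1 : ∀ y : M × (Fin k × ℤˣ),
      (stateMass ε w F y.1 + ε * sgn y.2.2 * stateSign ε w F y.1 y.2.1) / (2 * k)
        = ∑ Y, ∑ z with F z = y.1, w Y * streamWeight ε Y z * pairWeight ε Y y.2 := by
    intro y
    rw [stateMass, stateSign, Finset.mul_sum, ← Finset.sum_add_distrib, Finset.sum_div]
    refine Finset.sum_congr rfl fun Y _ => ?_
    rw [Finset.mul_sum, ← Finset.sum_add_distrib, Finset.sum_div]
    refine Finset.sum_congr rfl fun z _ => ?_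
    rw [pairWeight]
    ring
  simp_rw [e1]
  rw [Finset.sum_comm, stateMass]
  refine Finset.sum_congr rfl fun Y _ => ?_
  rw [Finset.sum_filter, Finset.sum_filter, ← (Fin.snocEquiv fun _ => Fin k × ℤˣ).sum_comp,
    Fintype.sum_prod_type (f := fun y : M × (Fin k × ℤˣ) => _), Fintype.sum_prod_type,
    Finset.sum_comm]
  have e2 : ∀ (z : Fin t → Fin k × ℤˣ) (x : Fin k × ℤˣ),
      (if F' ((Fin.snocEquiv fun _ => Fin k × ℤˣ) (x, z)) = ν then
        w Y * streamWeight ε Y ((Fin.snocEquiv fun _ => Fin k × ℤˣ) (x, z)) else 0) =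
      if g (F z) x = ν then w Y * streamWeight ε Y z * pairWeight ε Y x else 0 := by
    intro z x
    have e3 : streamWeight ε Y (Fin.snoc (α := fun _ => Fin k × ℤˣ) z x)
        = streamWeight ε Y z * pairWeight ε Y x := by
      simp [streamWeight, Fin.prod_univ_castSucc]
    simp [Fin.snocEquiv, hF, e3, mul_assoc]
  simp_rw [e2]
  rw [← Finset.sum_fiberwise Finset.univ F]
  refine Finset.sum_congr rfl fun μ _ => ?_
  rw [Finset.sum_comm]
  refine Finset.sum_congr rfl fun x _ => ?_
  by_cases h : g μ x = ν
  · rw [if_pos h]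
    refine Finset.sum_congr rfl fun z hz => ?_
    rw [(Finset.mem_filter.1 hz).2, if_pos h]
  · rw [if_neg h]
    refine Finset.sum_eq_zero fun z hz => ?_
    rw [(Finset.mem_filter.1 hz).2, if_neg h]

/-- One sample increases the divergence by at most `ε² / k` times the energy. -/
theorem stateKL_step (hk : 0 < k) (h0 : 0 ≤ ε) (h1 : ε ≤ 1) (hw : ∀ Y, 0 ≤ w Y)
    (F : (Fin t → Fin k × ℤˣ) → M) (g : M → Fin k × ℤˣ → M)
    (F' : (Fin (t + 1) → Fin k × ℤˣ) → M)
    (hF : ∀ z, F' z = g (F (Fin.init z)) (z (Fin.last t))) :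
    stateKL ε w F' ≤ stateKL ε w F + ε ^ 2 / k * signEnergy ε w F := by
  have hkR : (0 : ℝ) < k := by exact_mod_cast hk
  -- Data processing: the new memory is a function of the old memory and the sample. For `ε = 0` the
  -- pair has a product law.
  have hstep := sum_mul_log_div_map_le (fun y : M × (Fin k × ℤˣ) => g y.1 y.2)
    (fun y => (stateMass ε w F y.1 + ε * sgn y.2.2 * stateSign ε w F y.1 y.2.1) / (2 * k))
    (fun y => (stateMass 0 w F y.1 + 0 * sgn y.2.2 * stateSign 0 w F y.1 y.2.1) / (2 * k))
    ?_ ?_ ?_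
  · simp only [← stateMass_step ε w F g F' hF, ← stateMass_step 0 w F g F' hF] at hstep
    refine hstep.trans ?_
    rw [Fintype.sum_prod_type, stateKL, signEnergy, Finset.mul_sum, ← Finset.sum_add_distrib]
    refine Finset.sum_le_sum fun μ _ => ?_
    set q := stateMass ε w F μ with hq
    set p := stateMass 0 w F μ with hp
    have hq0 : 0 ≤ q := stateMass_nonneg h0 h1 hw F μ
    have hp0 : 0 ≤ p := stateMass_nonneg le_rfl zero_le_one hw F μ
    -- Splitting off `log (q / p)` and using `log y ≤ y - 1` leaves `r + r² / q` with `r = ±ε *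
    -- stateSign`; the terms linear in `r` cancel over the two points of a pair.
    have hterm : ∀ x : Fin k × ℤˣ,
        (q + ε * sgn x.2 * stateSign ε w F μ x.1) / (2 * k) *
          Real.log ((q + ε * sgn x.2 * stateSign ε w F μ x.1) / (2 * k) /
            ((p + 0 * sgn x.2 * stateSign 0 w F μ x.1) / (2 * k))) ≤
        ((q + ε * sgn x.2 * stateSign ε w F μ x.1) * (Real.log (q / p)) +
          ε * sgn x.2 * stateSign ε w F μ x.1 + ε ^ 2 * stateSign ε w F μ x.1 ^ 2 / q)
          / (2 * k) := by
      intro x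
      have hb := abs_stateSign_le h0 h1 hw F μ x.1
      set c := stateSign ε w F μ x.1
      rw [← hq] at hb
      rw [div_div_div_cancel_right₀ (by positivity), zero_mul, zero_mul, add_zero,
        div_mul_eq_mul_div]
      refine div_le_div_of_nonneg_right ?_ (by positivity)
      rcases hq0.eq_or_lt with hz | hqpos
      · rw [← hz] at hb
        rw [abs_nonpos_iff.1 hb, ← hz]
        simp
      have hppos : 0 < p := hp0.lt_of_ne fun h =>
        hqpos.ne' (stateMass_eq_zero h0 h1 hw F μ h.symm)
      set r := ε * sgn x.2 * c with hr
      have hr2 : ε ^ 2 * c ^ 2 = r ^ 2 := by rw [hr, mul_pow, mul_pow, sgn_sq, mul_one]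
      rw [hr2]
      have hrb : |r| ≤ q := by
        rw [hr, abs_mul, abs_mul, abs_sgn, mul_one, abs_of_nonneg h0]
        exact (mul_le_of_le_one_left (abs_nonneg _) h1).trans hb
      have hqr : 0 ≤ q + r := by linarith [(abs_le.1 hrb).1]
      -- If `q + r = 0`, the factor in front of the logarithm vanishes, and `r + r² / q` is zero as
      -- well.
      rcases hqr.eq_or_lt with hz | hqrpos
      · rw [← hz]
        have : r = -q := by linarith
        rw [this, neg_sq, pow_two, mul_div_assoc, div_self hqpos.ne']
        simp
      have hl : Real.log ((q + r) / p) = Real.log (q / p) + Real.log ((q + r) / q) := by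
        rw [← Real.log_mul (by positivity) (by positivity)]
        congr 1
        field_simp
      have hl2 := Real.log_le_sub_one_of_pos (x := (q + r) / q) (by positivity)
      rw [hl, mul_add, add_assoc]
      refine add_le_add le_rfl ((mul_le_mul_of_nonneg_left hl2 hqr).trans (le_of_eq ?_))
      field_simp
      ring
    refine (Finset.sum_le_sum fun x _ => hterm x).trans (le_of_eq ?_)
    rw [← Finset.sum_div, Fintype.sum_prod_type]
    simp_rw [sum_units]
    have e : ∀ i, (q + ε * sgn 1 * stateSign ε w F μ i) * Real.log (q / p) +
          ε * sgn 1 * stateSign ε w F μ i + ε ^ 2 * stateSign ε w F μ i ^ 2 / q +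
        ((q + ε * sgn (-1) * stateSign ε w F μ i) * Real.log (q / p) +
          ε * sgn (-1) * stateSign ε w F μ i + ε ^ 2 * stateSign ε w F μ i ^ 2 / q) =
        2 * (q * Real.log (q / p)) + 2 * ε ^ 2 * (stateSign ε w F μ i ^ 2 / q) := by
      intro i
      simp only [sgn_neg, sgn_one]
      ring
    simp_rw [e]
    rw [Finset.sum_add_distrib, ← Finset.mul_sum, Finset.sum_const, Finset.card_univ,
      Fintype.card_fin, nsmul_eq_mul, ← Finset.mul_sum]
    field_simp
  · intro y
    have hb := abs_stateSign_le h0 h1 hw F y.1 y.2.1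
    refine div_nonneg ?_ (by positivity)
    have : |ε * sgn y.2.2 * stateSign ε w F y.1 y.2.1| ≤ stateMass ε w F y.1 := by
      rw [abs_mul, abs_mul, abs_sgn, mul_one, abs_of_nonneg h0]
      exact (mul_le_of_le_one_left (abs_nonneg _) h1).trans hb
    linarith [(abs_le.1 this).1]
  · intro y
    rw [zero_mul, zero_mul, add_zero]
    exact div_nonneg (stateMass_nonneg le_rfl zero_le_one hw F y.1) (by positivity)
  · intro y h
    rw [zero_mul, zero_mul, add_zero, div_eq_zero_iff, or_iff_left (by positivity)] at h
    have hz := stateMass_eq_zero h0 h1 hw F y.1 h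
    have hb := abs_stateSign_le h0 h1 hw F y.1 y.2.1
    rw [hz] at hb
    rw [hz, abs_nonpos_iff.1 hb]
    simp

/-- For a sequence of memory contents that are updated sample by sample, the divergence is at most
`ε² / k` times the sum of the energies. -/
theorem stateKL_le (hk : 0 < k) (h0 : 0 ≤ ε) (h1 : ε ≤ 1) (hw : ∀ Y, 0 ≤ w Y)
    (F : ∀ t, (Fin t → Fin k × ℤˣ) → M) (g : ℕ → M → Fin k × ℤˣ → M)
    (hF : ∀ t z, F (t + 1) z = g t (F t (Fin.init z)) (z (Fin.last t))) (S : ℕ) :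
    stateKL ε w (F S) ≤ ε ^ 2 / k * ∑ t ∈ Finset.range S, signEnergy ε w (F t) := by
  induction S with
  | zero =>
    -- Before any sample the likelihood is an empty product, independent of `ε`.
    have hs : ∀ μ, stateMass ε w (F 0) μ = stateMass 0 w (F 0) μ := by
      intro μ
      refine Finset.sum_congr rfl fun Y _ => Finset.sum_congr rfl fun z _ => ?_
      congr 1
    simp only [stateKL, Finset.range_zero, Finset.sum_empty, mul_zero]
    refine (Finset.sum_eq_zero fun μ _ => ?_).le
    rw [← hs]
    by_cases h : stateMass ε w (F 0) μ = 0
    · rw [h, zero_mul]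
    · rw [div_self h, Real.log_one, mul_zero]
  | succ t ih =>
    rw [Finset.sum_range_succ, mul_add]
    exact (stateKL_step hk h0 h1 hw (F t) (g t) (F (t + 1)) (hF t)).trans (by linarith)

/-! ### Exponential moments of signs and the general energy bounds. -/

theorem sum_signs_prod {k : ℕ} (f : Fin k → ℤˣ → ℝ) :
    ∑ Y : Fin k → ℤˣ, ∏ i, f i (Y i) = ∏ i, (f i 1 + f i (-1)) := by
  have e := Finset.prod_univ_sum (fun _ : Fin k => (Finset.univ : Finset ℤˣ)) f
  rw [Fintype.piFinset_univ] at e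
  simp only [← e, sum_units]

theorem sum_signs_exp {k : ℕ} (x : Fin k → ℝ) :
    ∑ Y : Fin k → ℤˣ, (1 / 2 : ℝ) ^ k * Real.exp (∑ i, x i * sgn (Y i)) =
      ∏ i, Real.cosh (x i) := by
  have h := sum_signs_prod fun i σ => 1 / 2 * Real.exp (x i * sgn σ)
  simp only [Finset.prod_mul_distrib, Finset.prod_const, Finset.card_univ, Fintype.card_fin,
    ← Real.exp_sum] at h
  rw [h]
  refine Finset.prod_congr rfl fun i _ => ?_
  rw [Real.cosh_eq, sgn_neg, sgn_one]
  ring_nf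

theorem sum_signs_const (k : ℕ) : ∑ _Y : Fin k → ℤˣ, (1 / 2 : ℝ) ^ k = 1 := by
  simp

/-- From `cosh y = 1 + 2 * sinh (y/2)²` and `sinh (y/2) ≤ (y/2) * exp (y/2)`. The form `1 + O(x²)`
is what can later be averaged over a uniform pair index. -/
theorem cosh_le_one_add (x : ℝ) : Real.cosh x ≤ 1 + x ^ 2 / 2 * Real.exp |x| := by
  rw [← Real.cosh_abs, ← sq_abs]
  set y := |x| with hy
  have hy0 : 0 ≤ y := abs_nonneg x
  have h1 : Real.cosh y = 1 + 2 * Real.sinh (y / 2) ^ 2 := by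
    have := Real.cosh_two_mul (y / 2)
    have h2 := Real.cosh_sq (y / 2)
    rw [mul_div_cancel₀ y two_ne_zero] at this
    linarith
  have h2 : Real.sinh (y / 2) ≤ y / 2 * Real.exp (y / 2) := by
    rw [Real.sinh_eq]
    have := Real.add_one_le_exp (-y)
    have e : Real.exp (-(y / 2)) = Real.exp (-y) * Real.exp (y / 2) := by
      rw [← Real.exp_add]; congr 1; ring
    rw [e]
    nlinarith [Real.exp_pos (y / 2)]
  have h3 : 0 ≤ Real.sinh (y / 2) := Real.sinh_nonneg_iff.2 (by positivity)
  have h4 := pow_le_pow_left₀ h3 h2 2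
  have h5 : Real.exp (y / 2) ^ 2 = Real.exp y := by rw [← Real.exp_nat_mul]; congr 1; push_cast; ring
  rw [mul_pow, h5] at h4
  rw [h1]
  linarith

section

variable {k t : ℕ} {ε : ℝ} {w : (Fin k → ℤˣ) → ℝ} {M : Type*} [Fintype M] [DecidableEq M]

/-- Each conditional mean of a sign lies in `[-1, 1]`. This serves domains with room for a single
pair only. -/
theorem signEnergy_le_card (hk : 0 < k) (h0 : 0 ≤ ε) (h1 : ε ≤ 1) (hw : ∀ Y, 0 ≤ w Y)
    (hw1 : ∑ Y, w Y = 1) (F : (Fin t → Fin k × ℤˣ) → M) : signEnergy ε w F ≤ k := by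
  have h : ∀ μ i, stateSign ε w F μ i ^ 2 / stateMass ε w F μ ≤ stateMass ε w F μ := by
    intro μ i
    have hq := stateMass_nonneg h0 h1 hw F μ
    refine div_le_of_le_mul₀ hq hq ?_
    rw [← sq_abs, pow_two]
    exact mul_self_le_mul_self (abs_nonneg _) (abs_stateSign_le h0 h1 hw F μ i)
  calc signEnergy ε w F ≤ ∑ μ, ∑ _i : Fin k, stateMass ε w F μ :=
        Finset.sum_le_sum fun μ _ => Finset.sum_le_sum fun i _ => h μ i
    _ = k := by
        simp only [Finset.sum_const, Finset.card_univ, Fintype.card_fin, nsmul_eq_mul]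
        rw [← Finset.mul_sum, sum_stateMass hk hw1, mul_one]

/-- The energy is at most twice the number of nats of the memory. -/
theorem signEnergy_le_log_card [Nonempty M] (hk : 0 < k) (h0 : 0 ≤ ε) (h1 : ε ≤ 1)
    (F : (Fin t → Fin k × ℤˣ) → M) :
    signEnergy ε (fun _ => (1 / 2) ^ k) F ≤ 2 * Real.log (Fintype.card M) := by
  -- The bounded vector is the sign vector itself, on the joint space of signs and streams; its
  -- moments are products of `cosh (a i) ≤ exp (a i ^ 2 / 2)`, so `θ = 1` is admissible.
  have h := sum_sq_condMean_le
    (P := fun p : (Fin k → ℤˣ) × (Fin t → Fin k × ℤˣ) => (1 / 2) ^ k * streamWeight ε p.1 p.2)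
    (fun p => mul_nonneg (by positivity) (streamWeight_nonneg h0 h1 _))
    (by
      rw [Fintype.sum_prod_type]
      simp only [← Finset.mul_sum, sum_streamWeight hk, mul_one]
      exact sum_signs_const k)
    (fun p => F p.2) (fun p i => sgn (p.1 i)) (θ := 1) (b := 1) one_pos zero_le_one
    (fun p i => (abs_sgn _).le) ?_
  · rw [div_one] at h
    refine le_trans (le_of_eq ?_) h
    have e : ∀ (f : (Fin k → ℤˣ) → (Fin t → Fin k × ℤˣ) → ℝ) (μ : M),
        ∑ p : (Fin k → ℤˣ) × (Fin t → Fin k × ℤˣ) with F p.2 = μ, f p.1 p.2 =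
          ∑ Y, ∑ z with F z = μ, f Y z := by
      intro f μ
      simp only [Finset.sum_filter, Fintype.sum_prod_type]
    simp only [signEnergy, stateSign, stateMass, ← e]
  · intro a _
    rw [Fintype.sum_prod_type]
    have e : ∀ Y : Fin k → ℤˣ, ∑ z : Fin t → Fin k × ℤˣ,
        (1 / 2) ^ k * streamWeight ε Y z * Real.exp (1 * ∑ i, a i * sgn (Y i)) =
        (1 / 2) ^ k * Real.exp (∑ i, a i * sgn (Y i)) := by
      intro Y
      rw [← Finset.sum_mul, ← Finset.mul_sum, sum_streamWeight hk, mul_one, one_mul]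
    simp only [e]
    rw [sum_signs_exp, Finset.mul_sum, Real.exp_sum]
    refine Finset.prod_le_prod (fun i _ => (Real.cosh_pos _).le) fun i _ => ?_
    refine (Real.cosh_le_exp_half_sq _).trans (le_of_eq ?_)
    ring_nf

end

/-! ### Posterior signs, loads, and the energy of short streams. -/

/-- Relative differences `(f - g) / (f + g)` combine under products as `(u + v) / (1 + u * v)`,
which for nonnegative `u`, `v` is at most `u + v`; each differing factor therefore costs one `ε`. -/
theorem prod_sub_prod_le {ι : Type*} (s : Finset ι) (J : ι → Prop) [DecidablePred J]
    (f g : ι → ℝ) {ε : ℝ} (h0 : 0 ≤ ε) (hf : ∀ j, 0 ≤ f j) (hg : ∀ j, 0 ≤ g j)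
    (hJ : ∀ j, J j → f j - g j ≤ ε * (f j + g j)) (hJ' : ∀ j, ¬ J j → f j = g j) :
    ∏ j ∈ s, f j - ∏ j ∈ s, g j ≤
      ε * (s.filter J).card * (∏ j ∈ s, f j + ∏ j ∈ s, g j) := by
  classical
  induction s using Finset.induction_on with
  | empty => simp
  | insert j s hj ih =>
    rw [Finset.prod_insert hj, Finset.prod_insert hj]
    set a := ∏ j ∈ s, f j with ha
    set b := ∏ j ∈ s, g j with hb
    have ha0 : 0 ≤ a := Finset.prod_nonneg fun _ _ => hf _
    have hb0 : 0 ≤ b := Finset.prod_nonneg fun _ _ => hg _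
    by_cases h : J j
    · rw [Finset.filter_insert, if_pos h, Finset.card_insert_of_notMem (by simp [hj])]
      set c := ε * ((s.filter J).card : ℝ) with hc
      have hc0 : 0 ≤ c := by positivity
      have e : ε * (((s.filter J).card + 1 : ℕ) : ℝ) = c + ε := by rw [hc]; push_cast; ring
      rw [e]
      have hfg := hJ j h
      have hf0 := hf j
      have hg0 := hg j
      have hA : 0 ≤ f j * a := mul_nonneg hf0 ha0
      have hB : 0 ≤ g j * b := mul_nonneg hg0 hb0
      rcases le_or_gt (f j * a) (g j * b) with hle | hlt
      · have : 0 ≤ (c + ε) * (f j * a + g j * b) := by positivity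
        linarith
      -- Once the coefficient reaches `1` the claim is trivial; below `1` the factors `1 - c` and `1
      -- - ε` are nonnegative and the two ratio bounds can be multiplied.
      rcases le_or_gt 1 (c + ε) with h1 | h1
      · nlinarith
      have p1 : a * (1 - c) ≤ b * (1 + c) := by linarith
      have p2 : f j * (1 - ε) ≤ g j * (1 + ε) := by linarith
      have p3 := mul_le_mul p2 p1 (mul_nonneg ha0 (by linarith))
        (mul_nonneg hg0 (by linarith))
      have p4 : 0 ≤ c * ε * (f j * a - g j * b) :=
        mul_nonneg (by positivity) (by linarith)
      nlinarith
    · rw [Finset.filter_insert, if_neg h, hJ' j h]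
      have := mul_le_mul_of_nonneg_left ih (hg j)
      linarith

/-- The number of samples in the `i`-th pair. -/
def pairLoad {k t : ℕ} (i : Fin k) (z : Fin t → Fin k × ℤˣ) : ℕ :=
  (Finset.univ.filter fun j => (z j).1 = i).card

theorem prod_eq_prod_pow_pairLoad {k t : ℕ} (h : Fin k → ℝ) (z : Fin t → Fin k × ℤˣ) :
    ∏ j, h (z j).1 = ∏ i, h i ^ pairLoad i z := by
  rw [← Finset.prod_fiberwise Finset.univ (fun j => (z j).1) (fun j => h (z j).1)]
  refine Finset.prod_congr rfl fun i _ => ?_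
  rw [pairLoad, ← Finset.prod_const]
  exact Finset.prod_congr rfl fun j hj => by rw [(Finset.mem_filter.1 hj).2]

/-- The law of the stream for uniformly random signs. -/
noncomputable def mixtureWeight {k t : ℕ} (ε : ℝ) (z : Fin t → Fin k × ℤˣ) : ℝ :=
  ∑ Y : Fin k → ℤˣ, (1 / 2) ^ k * streamWeight ε Y z

/-- The expectation of the `i`-th sign on the event that the stream is `z`. -/
noncomputable def mixtureSign {k t : ℕ} (ε : ℝ) (i : Fin k) (z : Fin t → Fin k × ℤˣ) : ℝ :=
  ∑ Y : Fin k → ℤˣ, (1 / 2) ^ k * streamWeight ε Y z * sgn (Y i)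

/-- The conditional expectation of the `i`-th sign given the stream, cut off at the load `B`. -/
noncomputable def truncSign {k t : ℕ} (ε : ℝ) (B : ℕ) (i : Fin k) (z : Fin t → Fin k × ℤˣ) : ℝ :=
  if pairLoad i z ≤ B then mixtureSign ε i z / mixtureWeight ε z else 0

/-- The action of the sign vectors on the streams. -/
def signFlip {k t : ℕ} (τ : Fin k → ℤˣ) : (Fin t → Fin k × ℤˣ) ≃ (Fin t → Fin k × ℤˣ) where
  toFun z j := ((z j).1, τ (z j).1 * (z j).2)
  invFun z j := ((z j).1, τ (z j).1 * (z j).2)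
  left_inv z := by
    funext j
    simp [← mul_assoc, ← pow_two]
  right_inv z := by
    funext j
    simp [← mul_assoc, ← pow_two]

section

variable {k t : ℕ} {ε : ℝ}

theorem mixtureWeight_nonneg (h0 : 0 ≤ ε) (h1 : ε ≤ 1) (z : Fin t → Fin k × ℤˣ) :
    0 ≤ mixtureWeight ε z :=
  Finset.sum_nonneg fun _ _ => mul_nonneg (by positivity) (streamWeight_nonneg h0 h1 _)

theorem sum_mixtureWeight_mul (ε : ℝ) (h : Fin k → ℝ) :
    ∑ z : Fin t → Fin k × ℤˣ, mixtureWeight ε z * ∏ j, h (z j).1 = ((∑ i, h i) / k) ^ t := by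
  simp only [mixtureWeight, Finset.sum_mul]
  rw [Finset.sum_comm]
  simp only [mul_assoc, ← Finset.mul_sum, sum_streamWeight_mul]
  rw [Finset.mul_sum, ← Finset.sum_mul, sum_signs_const, one_mul]

theorem sum_mixtureWeight (hk : 0 < k) (ε : ℝ) (t : ℕ) :
    ∑ z : Fin t → Fin k × ℤˣ, mixtureWeight ε z = 1 := by
  have h := sum_mixtureWeight_mul (t := t) ε fun _ : Fin k => 1
  have hk : (k : ℝ) ≠ 0 := by positivity
  simpa [hk] using h

/-- Flipping one sign changes only the factors of the samples in that pair, and there are `pairLoad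
i z` of them. -/
theorem streamWeight_sub_le (h0 : 0 ≤ ε) (h1 : ε ≤ 1) (Y Y' : Fin k → ℤˣ) (i : Fin k)
    (hi : Y' i = -Y i) (hY : ∀ i', i' ≠ i → Y' i' = Y i') (z : Fin t → Fin k × ℤˣ) :
    streamWeight ε Y z - streamWeight ε Y' z ≤
      ε * pairLoad i z * (streamWeight ε Y z + streamWeight ε Y' z) := by
  refine prod_sub_prod_le Finset.univ (fun j => (z j).1 = i) _ _ h0
    (fun j => pairWeight_nonneg h0 h1 _) (fun j => pairWeight_nonneg h0 h1 _) ?_ ?_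
  · intro j hj
    rw [pairWeight, pairWeight, hj, hi, sgn_neg, ← add_div, ← sub_div, ← mul_div_assoc]
    refine div_le_div_of_nonneg_right ?_ (by positivity)
    rcases sgn_eq (z j).2 with h | h <;> rcases sgn_eq (Y i) with h' | h' <;> rw [h, h'] <;>
      linarith
  · intro j hj
    rw [pairWeight, pairWeight, hY _ hj]

/-- Pairing each `Y` with its flip `Y * s` at coordinate `i` turns twice the signed sum into a sum
of likelihood differences. In particular a pair without samples has posterior mean zero. -/
theorem abs_mixtureSign_le (h0 : 0 ≤ ε) (h1 : ε ≤ 1) (i : Fin k) (z : Fin t → Fin k × ℤˣ) :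
    |mixtureSign ε i z| ≤ ε * pairLoad i z * mixtureWeight ε z := by
  set s : Fin k → ℤˣ := Pi.mulSingle i (-1) with hs
  have hi : ∀ Y : Fin k → ℤˣ, (Y * s) i = -Y i := by intro Y; simp [hs]
  have hne : ∀ (Y : Fin k → ℤˣ) i', i' ≠ i → (Y * s) i' = Y i' := by
    intro Y i' h; simp [hs, h]
  have hd : ∀ Y : Fin k → ℤˣ, |streamWeight ε Y z - streamWeight ε (Y * s) z| ≤
      ε * pairLoad i z * (streamWeight ε Y z + streamWeight ε (Y * s) z) := by
    intro Y
    refine abs_sub_le_iff.2 ⟨streamWeight_sub_le h0 h1 _ _ i (hi Y) (hne Y) z, ?_⟩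
    rw [add_comm (streamWeight ε Y z)]
    exact streamWeight_sub_le h0 h1 _ _ i (by rw [hi, neg_neg]) (fun i' h => (hne Y i' h).symm) z
  have hflip : mixtureSign ε i z
      = ∑ Y : Fin k → ℤˣ, -((1 / 2) ^ k * streamWeight ε (Y * s) z * sgn (Y i)) := by
    rw [mixtureSign, ← Equiv.sum_comp (Equiv.mulRight s)]
    refine Finset.sum_congr rfl fun Y _ => ?_
    simp only [Equiv.coe_mulRight, hi, sgn_neg]
    ring
  have hw : mixtureWeight ε z = ∑ Y : Fin k → ℤˣ, (1 / 2) ^ k * streamWeight ε (Y * s) z := by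
    rw [mixtureWeight, ← Equiv.sum_comp (Equiv.mulRight s)]
    rfl
  have h2 : 2 * mixtureSign ε i z = ∑ Y : Fin k → ℤˣ,
      (1 / 2) ^ k * ((streamWeight ε Y z - streamWeight ε (Y * s) z) * sgn (Y i)) := by
    rw [two_mul]
    nth_rewrite 2 [hflip]
    rw [mixtureSign, ← Finset.sum_add_distrib]
    exact Finset.sum_congr rfl fun Y _ => by ring
  have h3 : |2 * mixtureSign ε i z| ≤ ε * pairLoad i z * (2 * mixtureWeight ε z) := by
    rw [h2, two_mul (mixtureWeight ε z)]
    nth_rewrite 2 [hw]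
    rw [mixtureWeight, ← Finset.sum_add_distrib, Finset.mul_sum]
    refine (Finset.abs_sum_le_sum_abs _ _).trans (Finset.sum_le_sum fun Y _ => ?_)
    rw [abs_mul, abs_mul, abs_sgn, mul_one, abs_of_nonneg (by positivity), ← mul_add,
      mul_left_comm]
    exact mul_le_mul_of_nonneg_left (hd Y) (by positivity)
  rw [abs_mul, abs_two] at h3
  linarith

theorem abs_mixtureSign_le_mixtureWeight (h0 : 0 ≤ ε) (h1 : ε ≤ 1) (i : Fin k)
    (z : Fin t → Fin k × ℤˣ) : |mixtureSign ε i z| ≤ mixtureWeight ε z := by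
  refine (Finset.abs_sum_le_sum_abs _ _).trans (Finset.sum_le_sum fun Y _ => ?_)
  rw [abs_mul, abs_sgn, mul_one,
    abs_of_nonneg (mul_nonneg (by positivity) (streamWeight_nonneg h0 h1 _))]

theorem abs_truncSign_le_pairLoad (h0 : 0 ≤ ε) (h1 : ε ≤ 1) (B : ℕ) (i : Fin k)
    (z : Fin t → Fin k × ℤˣ) : |truncSign ε B i z| ≤ ε * pairLoad i z := by
  rw [truncSign]
  split_ifs with h
  · rw [abs_div, abs_of_nonneg (mixtureWeight_nonneg h0 h1 z)]
    exact div_le_of_le_mul₀ (mixtureWeight_nonneg h0 h1 z) (by positivity)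
      (abs_mixtureSign_le h0 h1 i z)
  · rw [abs_zero]; positivity

theorem abs_truncSign_le (h0 : 0 ≤ ε) (h1 : ε ≤ 1) (B : ℕ) (i : Fin k)
    (z : Fin t → Fin k × ℤˣ) : |truncSign ε B i z| ≤ ε * B := by
  by_cases h : pairLoad i z ≤ B
  · refine (abs_truncSign_le_pairLoad h0 h1 B i z).trans ?_
    gcongr
  · rw [truncSign, if_neg h, abs_zero]; positivity

theorem mixtureWeight_mul_truncSign (h0 : 0 ≤ ε) (h1 : ε ≤ 1) (B : ℕ) (i : Fin k)
    (z : Fin t → Fin k × ℤˣ) : mixtureWeight ε z * truncSign ε B i z =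
      if pairLoad i z ≤ B then mixtureSign ε i z else 0 := by
  rw [truncSign]
  split_ifs
  · by_cases h : mixtureWeight ε z = 0
    · have := abs_mixtureSign_le_mixtureWeight h0 h1 i z
      rw [h] at this
      rw [h, abs_nonpos_iff.1 this]
      simp
    · field_simp
  · rw [mul_zero]

/-- Flipping the stream amounts to flipping the hidden signs; hence the mixture is invariant and the
posterior signs are equivariant. -/
theorem streamWeight_signFlip (ε : ℝ) (Y τ : Fin k → ℤˣ) (z : Fin t → Fin k × ℤˣ) :
    streamWeight ε Y (signFlip τ z) = streamWeight ε (τ * Y) z := by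
  refine Finset.prod_congr rfl fun j _ => ?_
  simp only [pairWeight, signFlip, Equiv.coe_fn_mk, sgn_mul, Pi.mul_apply]
  ring

theorem mixtureWeight_signFlip (ε : ℝ) (τ : Fin k → ℤˣ) (z : Fin t → Fin k × ℤˣ) :
    mixtureWeight ε (signFlip τ z) = mixtureWeight ε z := by
  simp only [mixtureWeight, streamWeight_signFlip]
  exact Equiv.sum_comp (Equiv.mulLeft τ) fun Y => (1 / 2 : ℝ) ^ k * streamWeight ε Y z

theorem mixtureSign_signFlip (ε : ℝ) (τ : Fin k → ℤˣ) (i : Fin k) (z : Fin t → Fin k × ℤˣ) :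
    mixtureSign ε i (signFlip τ z) = sgn (τ i) * mixtureSign ε i z := by
  simp only [mixtureSign, streamWeight_signFlip]
  rw [← Equiv.sum_comp (Equiv.mulLeft τ) fun Y => (1 / 2 : ℝ) ^ k * streamWeight ε Y z * sgn (Y i),
    Finset.mul_sum]
  refine Finset.sum_congr rfl fun Y _ => ?_
  have := sgn_sq (τ i)
  simp only [Equiv.coe_mulLeft, Pi.mul_apply, sgn_mul]
  linear_combination (-(1 / 2 : ℝ) ^ k * streamWeight ε (τ * Y) z * sgn (Y i)) * this

theorem truncSign_signFlip (ε : ℝ) (B : ℕ) (τ : Fin k → ℤˣ) (i : Fin k)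
    (z : Fin t → Fin k × ℤˣ) :
    truncSign ε B i (signFlip τ z) = sgn (τ i) * truncSign ε B i z := by
  have : pairLoad i (signFlip τ z) = pairLoad i z := rfl
  simp only [truncSign, this, mixtureWeight_signFlip, mixtureSign_signFlip]
  split_ifs
  · rw [mul_div_assoc]
  · rw [mul_zero]

/-- The exponential moments of the truncated conditional expectations of the signs. -/
theorem sum_mixtureWeight_mul_exp_le (hk : 0 < k) (h0 : 0 ≤ ε) (h1 : ε ≤ 1) (B : ℕ) {θ : ℝ}
    (hθ : 0 ≤ θ) (a : Fin k → ℝ) (ha : ∀ i, |a i| ≤ ε * B) :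
    ∑ z : Fin t → Fin k × ℤˣ, mixtureWeight ε z * Real.exp (θ * ∑ i, a i * truncSign ε B i z) ≤
      Real.exp (t / k * ((θ * (ε * B)) ^ 2 / 2 * Real.exp (θ * (ε * B) ^ 2)) *
        ∑ i, a i ^ 2) := by
  set κ : ℝ := (θ * (ε * B)) ^ 2 / 2 * Real.exp (θ * (ε * B) ^ 2) with hκ
  have hκ0 : 0 ≤ κ := by positivity
  -- Symmetrisation: the invariance inserts arbitrary signs `τ` in front of the posterior means, and
  -- averaging over `τ` turns the exponential into a product of `cosh`.
  have hsymm : ∀ τ : Fin k → ℤˣ,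
      ∑ z : Fin t → Fin k × ℤˣ, mixtureWeight ε z *
        Real.exp (θ * ∑ i, a i * truncSign ε B i z) =
      ∑ z : Fin t → Fin k × ℤˣ, mixtureWeight ε z *
        Real.exp (∑ i, (θ * a i * truncSign ε B i z) * sgn (τ i)) := by
    intro τ
    rw [← (signFlip τ).sum_comp]
    refine Finset.sum_congr rfl fun z _ => ?_
    rw [mixtureWeight_signFlip, Finset.mul_sum]
    congr 2
    refine Finset.sum_congr rfl fun i _ => ?_
    rw [truncSign_signFlip]
    ring
  -- The power `pairLoad` is the point: for load zero the left side is `1`, and the product over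
  -- pairs becomes a product over samples, whose mean is explicit.
  have hcosh : ∀ (z : Fin t → Fin k × ℤˣ) i, Real.cosh (θ * a i * truncSign ε B i z) ≤
      (1 + κ * a i ^ 2) ^ pairLoad i z := by
    intro z i
    have hα : 0 ≤ κ * a i ^ 2 := by positivity
    rcases Nat.eq_zero_or_pos (pairLoad i z) with h | h
    · have := abs_truncSign_le_pairLoad h0 h1 B i z
      rw [h, Nat.cast_zero, mul_zero] at this
      rw [h, abs_nonpos_iff.1 this]
      simp
    have hu := abs_truncSign_le h0 h1 B i z
    have hsq : (θ * a i * truncSign ε B i z) ^ 2 ≤ (θ * (ε * B)) ^ 2 * a i ^ 2 := by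
      have : truncSign ε B i z ^ 2 ≤ (ε * B) ^ 2 := by
        rw [← sq_abs]; exact pow_le_pow_left₀ (abs_nonneg _) hu 2
      have := mul_le_mul_of_nonneg_left this (by positivity : 0 ≤ θ ^ 2 * a i ^ 2)
      linarith
    have habs : |θ * a i * truncSign ε B i z| ≤ θ * (ε * B) ^ 2 := by
      rw [abs_mul, abs_mul, abs_of_nonneg hθ, pow_two, mul_assoc]
      exact mul_le_mul_of_nonneg_left (mul_le_mul (ha i) hu (abs_nonneg _) (by positivity)) hθ
    calc Real.cosh (θ * a i * truncSign ε B i z)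
        ≤ 1 + (θ * a i * truncSign ε B i z) ^ 2 / 2 * Real.exp |θ * a i * truncSign ε B i z| :=
          cosh_le_one_add _
      _ ≤ 1 + ((θ * (ε * B)) ^ 2 * a i ^ 2) / 2 * Real.exp (θ * (ε * B) ^ 2) := by
          gcongr
      _ = 1 + κ * a i ^ 2 := by rw [hκ]; ring
      _ ≤ _ := le_self_pow₀ (by linarith) h.ne'
  have hkR : (0 : ℝ) < k := by exact_mod_cast hk
  calc ∑ z : Fin t → Fin k × ℤˣ, mixtureWeight ε z *
        Real.exp (θ * ∑ i, a i * truncSign ε B i z)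
      = ∑ τ : Fin k → ℤˣ, (1 / 2) ^ k * ∑ z : Fin t → Fin k × ℤˣ, mixtureWeight ε z *
        Real.exp (∑ i, (θ * a i * truncSign ε B i z) * sgn (τ i)) := by
        simp only [← hsymm]
        rw [← Finset.sum_mul, sum_signs_const, one_mul]
    _ = ∑ z : Fin t → Fin k × ℤˣ, mixtureWeight ε z *
          ∏ i, Real.cosh (θ * a i * truncSign ε B i z) := by
        simp only [Finset.mul_sum, ← sum_signs_exp]
        rw [Finset.sum_comm]
        exact Finset.sum_congr rfl fun z _ => Finset.sum_congr rfl fun τ _ => by ring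
    _ ≤ ∑ z : Fin t → Fin k × ℤˣ, mixtureWeight ε z * ∏ j, (1 + κ * a (z j).1 ^ 2) := by
        refine Finset.sum_le_sum fun z _ =>
          mul_le_mul_of_nonneg_left ?_ (mixtureWeight_nonneg h0 h1 z)
        rw [prod_eq_prod_pow_pairLoad (fun i => 1 + κ * a i ^ 2)]
        exact Finset.prod_le_prod (fun i _ => (Real.cosh_pos _).le) fun i _ => hcosh z i
    _ = (1 + κ * (∑ i, a i ^ 2) / k) ^ t := by
        rw [sum_mixtureWeight_mul ε fun i => 1 + κ * a i ^ 2]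
        congr 1
        rw [Finset.sum_add_distrib, ← Finset.mul_sum, Finset.sum_const, Finset.card_univ,
          Fintype.card_fin, nsmul_eq_mul]
        field_simp
    _ ≤ Real.exp (κ * (∑ i, a i ^ 2) / k) ^ t := by
        have hs : 0 ≤ ∑ i, a i ^ 2 := Finset.sum_nonneg fun _ _ => sq_nonneg _
        refine pow_le_pow_left₀ (by positivity) ?_ t
        rw [add_comm]
        exact Real.add_one_le_exp _
    _ = _ := by
        rw [← Real.exp_nat_mul]
        congr 1
        ring

/-- Large loads are improbable. -/
theorem sum_mixtureWeight_pairLoad_le (hk : 0 < k) (h0 : 0 ≤ ε) (h1 : ε ≤ 1) (B : ℕ) (i : Fin k)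
    {x : ℝ} (hx : 1 ≤ x) :
    ∑ z : Fin t → Fin k × ℤˣ with ¬ pairLoad i z ≤ B, mixtureWeight ε z ≤
      x⁻¹ ^ B * Real.exp (t / k * x) := by
  have hx0 : 0 < x := by linarith
  have hkR : (0 : ℝ) < k := by exact_mod_cast hk
  calc ∑ z : Fin t → Fin k × ℤˣ with ¬ pairLoad i z ≤ B, mixtureWeight ε z
      -- Chernoff: where the load exceeds `B`, `x ^ load` is at least `x ^ B`.
      ≤ ∑ z : Fin t → Fin k × ℤˣ with ¬ pairLoad i z ≤ B,
          x⁻¹ ^ B * (mixtureWeight ε z * ∏ j, if (z j).1 = i then x else 1) := by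
        refine Finset.sum_le_sum fun z hz => ?_
        have hB := (not_le.1 (Finset.mem_filter.1 hz).2).le
        have e : (∏ j, if (z j).1 = i then x else 1) = x ^ pairLoad i z := by
          rw [prod_eq_prod_pow_pairLoad (fun i' => if i' = i then x else 1)]
          simp
        rw [e, mul_left_comm]
        refine le_mul_of_one_le_right (mixtureWeight_nonneg h0 h1 z) ?_
        rw [inv_pow, ← div_eq_inv_mul, one_le_div (by positivity)]
        exact pow_le_pow_right₀ hx hB
    _ ≤ ∑ z : Fin t → Fin k × ℤˣ,
          x⁻¹ ^ B * (mixtureWeight ε z * ∏ j, if (z j).1 = i then x else 1) := by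
        refine Finset.sum_le_sum_of_subset_of_nonneg (Finset.subset_univ _) fun z _ _ =>
          mul_nonneg (by positivity) (mul_nonneg (mixtureWeight_nonneg h0 h1 z)
            (Finset.prod_nonneg fun j _ => ?_))
        split_ifs <;> positivity
    _ = x⁻¹ ^ B * ((k - 1 + x) / k) ^ t := by
        rw [← Finset.mul_sum, sum_mixtureWeight_mul ε fun i' => if i' = i then x else 1]
        congr 3
        rw [← Finset.add_sum_erase _ _ (Finset.mem_univ i), if_pos rfl,
          Finset.sum_congr rfl (g := fun _ => (1 : ℝ))
            fun j hj => if_neg (Finset.mem_erase.1 hj).1]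
        simp [Nat.cast_sub (Nat.one_le_iff_ne_zero.2 hk.ne')]
        ring
    _ ≤ x⁻¹ ^ B * Real.exp (x / k) ^ t := by
        refine mul_le_mul_of_nonneg_left (pow_le_pow_left₀ ?_ ?_ t) (by positivity)
        · exact div_nonneg (by linarith) hkR.le
        · refine le_trans (le_of_eq ?_) ((sub_le_self _ (by positivity)).trans
            (Real.add_one_le_exp (x / k)) : x / k + 1 - 1 / k ≤ _)
          field_simp
          ring
    _ = _ := by
        rw [← Real.exp_nat_mul]
        congr 2
        ring

/-- The energy bound for streams so short that most pairs receive few samples. -/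
theorem signEnergy_le_of_sparse {M : Type*} [Fintype M] [DecidableEq M] [Nonempty M]
    (hk : 0 < k) (h0 : 0 ≤ ε) (h1 : ε ≤ 1) (B : ℕ) {θ x : ℝ} (hθ : 0 < θ) (hx : 1 ≤ x)
    (hsparse : t / k * ((θ * (ε * B)) ^ 2 / 2 * Real.exp (θ * (ε * B) ^ 2)) ≤ θ / 2)
    (F : (Fin t → Fin k × ℤˣ) → M) :
    signEnergy ε (fun _ => (1 / 2) ^ k) F ≤
      4 / θ * Real.log (Fintype.card M) + 2 * k * (x⁻¹ ^ B * Real.exp (t / k * x)) := by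
  -- Now the bounded vector is the truncated posterior, a function of the stream alone; `hsparse`
  -- says exactly that its moments are subgaussian at `θ`.
  have hG := sum_sq_condMean_le (P := fun z : Fin t → Fin k × ℤˣ => mixtureWeight ε z)
    (mixtureWeight_nonneg h0 h1) (sum_mixtureWeight hk ε t) F (fun z i => truncSign ε B i z) hθ
    (by positivity : 0 ≤ ε * B) (fun z i => abs_truncSign_le h0 h1 B i z)
    (fun a ha => (sum_mixtureWeight_mul_exp_le hk h0 h1 B hθ.le a ha).trans
      (Real.exp_le_exp.2 (mul_le_mul_of_nonneg_right hsparse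
        (Finset.sum_nonneg fun _ _ => sq_nonneg _))))
  have hmass : ∀ μ, stateMass ε (fun _ => (1 / 2) ^ k) F μ =
      ∑ z with F z = μ, mixtureWeight ε z := by
    intro μ
    simp only [stateMass, mixtureWeight]
    rw [Finset.sum_comm]
  have hsign : ∀ μ i, stateSign ε (fun _ => (1 / 2) ^ k) F μ i =
      ∑ z with F z = μ, mixtureSign ε i z := by
    intro μ i
    simp only [stateSign, mixtureSign]
    rw [Finset.sum_comm]
  -- The posterior sign splits into its truncated part and the part from heavy loads; the latter
  -- contributes at most the mass of heavy loads.
  have hterm : ∀ μ i,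
      stateSign ε (fun _ => (1 / 2) ^ k) F μ i ^ 2 / stateMass ε (fun _ => (1 / 2) ^ k) F μ ≤
      2 * ((∑ z with F z = μ, mixtureWeight ε z * truncSign ε B i z) ^ 2 /
        ∑ z with F z = μ, mixtureWeight ε z) +
      2 * ∑ z with F z = μ, if ¬ pairLoad i z ≤ B then mixtureWeight ε z else 0 := by
    intro μ i
    rw [hmass, hsign]
    set q := ∑ z with F z = μ, mixtureWeight ε z with hq
    set c := ∑ z with F z = μ, mixtureWeight ε z * truncSign ε B i z with hc
    set r := ∑ z with F z = μ, if ¬ pairLoad i z ≤ B then mixtureWeight ε z else 0 with hr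
    set d := ∑ z with F z = μ, if ¬ pairLoad i z ≤ B then mixtureSign ε i z else 0 with hd
    have hq0 : 0 ≤ q := Finset.sum_nonneg fun z _ => mixtureWeight_nonneg h0 h1 z
    have hr0 : 0 ≤ r := Finset.sum_nonneg fun z _ => by
      split_ifs <;> first | exact le_rfl | exact mixtureWeight_nonneg h0 h1 z
    have hrq : r ≤ q := Finset.sum_le_sum fun z _ => by
      split_ifs <;> first | exact le_rfl | exact mixtureWeight_nonneg h0 h1 z
    have hdr : |d| ≤ r := (Finset.abs_sum_le_sum_abs _ _).trans (Finset.sum_le_sum fun z _ => by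
      split_ifs
      · rw [abs_zero]
      · exact abs_mixtureSign_le_mixtureWeight h0 h1 i z)
    have e : ∑ z with F z = μ, mixtureSign ε i z = c + d := by
      rw [hc, hd, ← Finset.sum_add_distrib]
      refine Finset.sum_congr rfl fun z _ => ?_
      rw [mixtureWeight_mul_truncSign h0 h1]
      split_ifs <;> simp
    rw [e]
    have hdq : d ^ 2 / q ≤ r := by
      refine div_le_of_le_mul₀ hq0 hr0 ?_
      rw [← sq_abs, pow_two]
      exact mul_le_mul hdr (hdr.trans hrq) (abs_nonneg _) hr0
    calc (c + d) ^ 2 / q ≤ (2 * c ^ 2 + 2 * d ^ 2) / q :=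
          div_le_div_of_nonneg_right (by nlinarith [sq_nonneg (c - d)]) hq0
      _ = 2 * (c ^ 2 / q) + 2 * (d ^ 2 / q) := by ring
      _ ≤ _ := by linarith
  calc signEnergy ε (fun _ => (1 / 2) ^ k) F
      ≤ ∑ μ, ∑ i, (2 * ((∑ z with F z = μ, mixtureWeight ε z * truncSign ε B i z) ^ 2 /
          ∑ z with F z = μ, mixtureWeight ε z) +
        2 * ∑ z with F z = μ, if ¬ pairLoad i z ≤ B then mixtureWeight ε z else 0) :=
        Finset.sum_le_sum fun μ _ => Finset.sum_le_sum fun i _ => hterm μ i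
    _ = 2 * ∑ μ, ∑ i, (∑ z with F z = μ, mixtureWeight ε z * truncSign ε B i z) ^ 2 /
          (∑ z with F z = μ, mixtureWeight ε z) +
        2 * ∑ i : Fin k, ∑ z : Fin t → Fin k × ℤˣ with ¬ pairLoad i z ≤ B, mixtureWeight ε z := by
        simp only [Finset.sum_add_distrib, ← Finset.mul_sum]
        congr 2
        rw [Finset.sum_comm]
        refine Finset.sum_congr rfl fun i _ => ?_
        rw [Finset.sum_fiberwise, Finset.sum_filter]
    _ ≤ 2 * (2 / θ * Real.log (Fintype.card M)) +
        2 * ∑ _i : Fin k, (x⁻¹ ^ B * Real.exp (t / k * x)) := by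
        have := Finset.sum_le_sum fun i (_ : i ∈ (Finset.univ : Finset (Fin k))) =>
          sum_mixtureWeight_pairLoad_le (t := t) hk h0 h1 B i hx
        linarith
    _ = _ := by
        rw [Finset.sum_const, Finset.card_univ, Fintype.card_fin, nsmul_eq_mul]
        ring

end

/-! ### Distance from monotone. -/

theorem sum_Icc_even_sub_odd_le {G : ℕ → ℝ} (hG : Antitone G) {p q : ℕ} (hpq : p ≤ q) :
    ∑ j ∈ Finset.Icc p q, (G (2 * j) - G (2 * j + 1)) ≤ G (2 * p) - G (2 * q + 1) := by
  induction q, hpq using Nat.le_induction with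
  | base => simp
  | succ q hpq ih =>
    rw [Finset.sum_Icc_succ_top (by omega)]
    have := hG (by omega : 2 * q + 1 ≤ 2 * (q + 1))
    linarith

/-- Negative signs only lower the sum, and the positive ones sit between `i₀` and `i₁`, where the
disjoint drops of `G` telescope. -/
theorem sum_sgn_mul_even_sub_odd_le {k : ℕ} {G : ℕ → ℝ} (hG : Antitone G) (Y : Fin k → ℤˣ)
    {i₀ i₁ : Fin k} (h : i₀ ≤ i₁) (hY : ∀ i, Y i = 1 → i₀ ≤ i ∧ i ≤ i₁) :
    ∑ i : Fin k, sgn (Y i) * (G (2 * i) - G (2 * i + 1)) ≤ G (2 * i₀) - G (2 * i₁ + 1) := by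
  have hd : ∀ j, 0 ≤ G (2 * j) - G (2 * j + 1) := fun j => sub_nonneg.2 (hG (by omega))
  calc ∑ i : Fin k, sgn (Y i) * (G (2 * i) - G (2 * i + 1))
      ≤ ∑ i : Fin k, if (i : ℕ) ∈ Finset.Icc (i₀ : ℕ) i₁ then G (2 * i) - G (2 * i + 1) else 0 := by
        refine Finset.sum_le_sum fun i _ => ?_
        rcases Int.units_eq_one_or (Y i) with h1 | h1
        · have hm : (i : ℕ) ∈ Finset.Icc (i₀ : ℕ) i₁ := Finset.mem_Icc.2 (hY i h1)
          rw [h1, sgn_one, one_mul, if_pos hm]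
        · rw [h1, sgn_neg, sgn_one, neg_one_mul]
          have := hd i
          split_ifs <;> linarith
    _ = ∑ j ∈ Finset.range k,
          if j ∈ Finset.Icc (i₀ : ℕ) i₁ then G (2 * j) - G (2 * j + 1) else 0 :=
        Fin.sum_univ_eq_sum_range
          (fun j => if j ∈ Finset.Icc (i₀ : ℕ) i₁ then G (2 * j) - G (2 * j + 1) else 0) k
    _ = ∑ j ∈ Finset.Icc (i₀ : ℕ) i₁, (G (2 * j) - G (2 * j + 1)) := by
        rw [← Finset.sum_filter]
        congr 1
        ext j
        have := i₁.isLt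
        simp only [Finset.mem_filter, Finset.mem_range, Finset.mem_Icc]
        omega
    _ ≤ _ := sum_Icc_even_sub_odd_le hG h

/-- The `ℓ¹` deviation of a paired perturbation from a non-increasing sequence, if no pair is
increased at its left point. -/
theorem le_sum_abs_of_forall_neg {k : ℕ} (hk : 0 < k) (ε : ℝ) {G : ℕ → ℝ}
    (hG : Antitone G) (Y : Fin k → ℤˣ) (hY : ∀ i, Y i ≠ 1) :
    ε ≤ ∑ i : Fin k, (|(1 + ε * sgn (Y i)) / (2 * k) - G (2 * i)| +
      |(1 - ε * sgn (Y i)) / (2 * k) - G (2 * i + 1)|) := by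
  have hkR : (0 : ℝ) < k := by exact_mod_cast hk
  calc ε = ∑ _i : Fin k, ε / k := by
        rw [Finset.sum_const, Finset.card_univ, Fintype.card_fin, nsmul_eq_mul]
        field_simp
    _ ≤ _ := by
        refine Finset.sum_le_sum fun i _ => ?_
        rw [(Int.units_eq_one_or (Y i)).resolve_left (hY i), sgn_neg, sgn_one]
        have h1 := neg_abs_le ((1 + ε * -1) / (2 * k) - G (2 * i))
        have h2 := le_abs_self ((1 - ε * -1) / (2 * k) - G (2 * i + 1))
        have h3 := hG (by omega : 2 * (i : ℕ) ≤ 2 * i + 1)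
        have e : (1 - ε * -1) / (2 * k) - (1 + ε * -1) / (2 * k) = ε / k := by field_simp; ring
        linarith

/-- The `ℓ¹` deviation of a paired perturbation from a non-increasing sequence. -/
theorem le_sum_abs_pairWeight_sub {k : ℕ} (hk : 0 < k) {ε : ℝ} (h0 : 0 ≤ ε) {G : ℕ → ℝ}
    (hG : Antitone G) (Y : Fin k → ℤˣ) :
    ε * (1 - 1 / k) ≤ ∑ i : Fin k, (|(1 + ε * sgn (Y i)) / (2 * k) - G (2 * i)| +
      |(1 - ε * sgn (Y i)) / (2 * k) - G (2 * i + 1)|) := by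
  have hkR : (0 : ℝ) < k := by exact_mod_cast hk
  by_cases hP : ∀ i, Y i ≠ 1
  · refine le_trans ?_ (le_sum_abs_of_forall_neg hk ε hG Y hP)
    exact mul_le_of_le_one_right h0 (by linarith [show (0 : ℝ) ≤ 1 / k by positivity])
  push Not at hP
  obtain ⟨j, hj⟩ := hP
  set P : Finset (Fin k) := Finset.univ.filter fun i => Y i = 1 with hPdef
  have hne : P.Nonempty := ⟨j, by simp [hPdef, hj]⟩
  set i₀ := P.min' hne with hi₀
  set i₁ := P.max' hne with hi₁
  have hY₀ : Y i₀ = 1 := (Finset.mem_filter.1 (P.min'_mem hne)).2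
  have hY₁ : Y i₁ = 1 := (Finset.mem_filter.1 (P.max'_mem hne)).2
  have hbd : ∀ i, Y i = 1 → i₀ ≤ i ∧ i ≤ i₁ := fun i hi =>
    ⟨P.min'_le i (by simp [hPdef, hi]), P.le_max' i (by simp [hPdef, hi])⟩
  have htel := sum_sgn_mul_even_sub_odd_le hG Y (hbd i₁ hY₁).1 hbd
  -- Each deviation is bounded below linearly, with signs given by `Y`, except at the left point of
  -- the first positive pair and the right point of the last, where it is bounded by `0`. These two
  -- omissions cost `ε / k` and release `G (2 * i₀) - G (2 * i₁ + 1)`, which pays for the telescoped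
  -- drops.
  have hterm : ∀ i : Fin k, ε / k - sgn (Y i) * (G (2 * i) - G (2 * i + 1)) -
      (if i = i₀ then (1 + ε) / (2 * k) - G (2 * i) else 0) +
      (if i = i₁ then (1 - ε) / (2 * k) - G (2 * i + 1) else 0) ≤
      |(1 + ε * sgn (Y i)) / (2 * k) - G (2 * i)| +
      |(1 - ε * sgn (Y i)) / (2 * k) - G (2 * i + 1)| := by
    intro i
    have a1 := le_abs_self ((1 + ε * sgn (Y i)) / (2 * k) - G (2 * i))
    have a2 := neg_abs_le ((1 + ε * sgn (Y i)) / (2 * k) - G (2 * i))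
    have a3 := le_abs_self ((1 - ε * sgn (Y i)) / (2 * k) - G (2 * i + 1))
    have a4 := neg_abs_le ((1 - ε * sgn (Y i)) / (2 * k) - G (2 * i + 1))
    have e : (1 + ε) / (2 * k) - (1 - ε) / (2 * k) = ε / k := by field_simp; ring
    rcases Int.units_eq_one_or (Y i) with h1 | h1
    · simp only [h1, sgn_one, mul_one, one_mul] at a1 a2 a3 a4 ⊢
      split_ifs <;> linarith
    · have n0 : i ≠ i₀ := fun h => absurd (h1.symm.trans (h ▸ hY₀)) (by decide)
      have n1 : i ≠ i₁ := fun h => absurd (h1.symm.trans (h ▸ hY₁)) (by decide)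
      rw [if_neg n0, if_neg n1]
      simp only [h1, sgn_neg, sgn_one, mul_neg, mul_one, ← sub_eq_add_neg, sub_neg_eq_add]
        at a1 a2 a3 a4 ⊢
      linarith
  have hsum := Finset.sum_le_sum fun i (_ : i ∈ Finset.univ) => hterm i
  rw [Finset.sum_add_distrib, Finset.sum_sub_distrib, Finset.sum_sub_distrib,
    Finset.sum_ite_eq' , Finset.sum_ite_eq', if_pos (Finset.mem_univ _),
    if_pos (Finset.mem_univ _), Finset.sum_const, Finset.card_univ, Fintype.card_fin,
    nsmul_eq_mul] at hsum
  have e1 : (k : ℝ) * (ε / k) = ε := by field_simp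
  have e2 : (1 + ε) / (2 * k) - (1 - ε) / (2 * k) = ε * (1 / k) := by field_simp; ring
  rw [e1] at hsum
  linarith

/-- The position of a point of the paired domain. -/
def pairIndex {k n : ℕ} (h : 2 * k ≤ n) (z : Fin k × ℤˣ) : Fin n :=
  ⟨2 * z.1 + if z.2 = 1 then 0 else 1, by have := z.1.isLt; split_ifs <;> omega⟩

theorem pairIndex_injective {k n : ℕ} (h : 2 * k ≤ n) : Function.Injective (pairIndex h) := by
  rintro ⟨i, σ⟩ ⟨j, τ⟩ hij
  simp only [pairIndex, Fin.mk.injEq] at hij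
  rcases Int.units_eq_one_or σ with rfl | rfl <;> rcases Int.units_eq_one_or τ with rfl | rfl <;>
    simp [show ¬ ((-1 : ℤˣ) = 1) by decide, Fin.ext_iff] at hij ⊢ <;> omega

/-- The values of a monotone distribution, continued by `0`. -/
theorem IsMonotoneDist.antitone {n : ℕ} {D : PMF (Fin n)} (hD : IsMonotoneDist D) :
    Antitone fun x : ℕ => if h : x < n then (D ⟨x, h⟩).toReal else 0 := by
  intro x y hxy
  simp only
  split_ifs with h1 h2
  · exact ENNReal.toReal_mono (D.apply_ne_top _) (hD _ _ hxy)
  · omega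
  · exact ENNReal.toReal_nonneg
  · exact le_rfl

theorem sum_abs_pair_le_two_mul_tvDist {k n : ℕ} (h : 2 * k ≤ n) {ε : ℝ} {Y : Fin k → ℤˣ}
    {D : PMF (Fin n)} (hD : ∀ z, (D (pairIndex h z)).toReal = pairWeight ε Y z) (D' : PMF (Fin n))
    {G : ℕ → ℝ} (hG : G = fun x : ℕ => if h : x < n then (D' ⟨x, h⟩).toReal else 0) :
    ∑ i : Fin k, (|(1 + ε * sgn (Y i)) / (2 * k) - G (2 * i)| +
      |(1 - ε * sgn (Y i)) / (2 * k) - G (2 * i + 1)|) ≤ 2 * tvDist D D' := by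
  have e : ∑ i : Fin k, (|(1 + ε * sgn (Y i)) / (2 * k) - G (2 * i)| +
      |(1 - ε * sgn (Y i)) / (2 * k) - G (2 * i + 1)|) =
      ∑ z, |(D (pairIndex h z)).toReal - (D' (pairIndex h z)).toReal| := by
    rw [Fintype.sum_prod_type]
    refine Finset.sum_congr rfl fun i _ => ?_
    rw [sum_units, hD, hD, hG]
    have hi := i.isLt
    have l0 : 2 * (i : ℕ) < n := by omega
    have l1 : 2 * (i : ℕ) + 1 < n := by omega
    simp only [pairIndex, pairWeight, l0, l1, dif_pos, sgn_one, sgn_neg, if_pos, mul_one, mul_neg,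
      if_neg (show ¬ ((-1 : ℤˣ) = 1) by decide), add_zero, neg_mul, ← sub_eq_add_neg]
  rw [e, tvDist, ← mul_assoc, mul_one_div_cancel two_ne_zero, one_mul,
    ← Finset.sum_image (f := fun x => |(D x).toReal - (D' x).toReal|)
      fun a _ b _ hab => pairIndex_injective h hab]
  exact Finset.sum_le_sum_of_subset_of_nonneg (Finset.subset_univ _) fun _ _ _ => abs_nonneg _

/-- For `k ≥ 3` the distance is at least `ε / 2 * (1 - 1/3) = ε / 3`; with `k = 2` the same estimate
would give only `ε / 4`, without strictness. -/
theorem farFromMonotone_of_pairWeight {k n : ℕ} (hk : 3 ≤ k) (h : 2 * k ≤ n) {ε : ℝ} (h0 : 0 < ε)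
    {Y : Fin k → ℤˣ} {D : PMF (Fin n)}
    (hD : ∀ z, (D (pairIndex h z)).toReal = pairWeight ε Y z) : FarFromMonotone (ε / 4) D := by
  intro D' hD'
  have h1 := sum_abs_pair_le_two_mul_tvDist h hD D' rfl
  have h2 := (le_sum_abs_pairWeight_sub (by omega) h0.le hD'.antitone Y).trans h1
  have h3 : (1 : ℝ) / k ≤ 1 / 3 := one_div_le_one_div_of_le (by norm_num) (by exact_mod_cast hk)
  nlinarith

/-- Without positive signs there is no boundary loss, so the distance is at least `ε / 2` even for a
single pair. -/
theorem farFromMonotone_of_forall_neg {k n : ℕ} (hk : 0 < k) (h : 2 * k ≤ n) {ε : ℝ} (h0 : 0 < ε)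
    {Y : Fin k → ℤˣ} (hY : ∀ i, Y i ≠ 1) {D : PMF (Fin n)}
    (hD : ∀ z, (D (pairIndex h z)).toReal = pairWeight ε Y z) : FarFromMonotone (ε / 4) D := by
  intro D' hD'
  have h1 := sum_abs_pair_le_two_mul_tvDist h hD D' rfl
  have h2 := (le_sum_abs_of_forall_neg hk ε hD'.antitone Y hY).trans h1
  linarith

theorem pairedPerturbation_farFromMonotone {k : ℕ} (hk : 3 ≤ k) {ε : ℝ} (h0 : 0 < ε) (h1 : ε ≤ 1)
    (hk0 : 0 < k) (Y : Fin k → ℤˣ) :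
    FarFromMonotone (ε / 4) (pairedPerturbation hk0 h0.le h1 Y) := by
  refine farFromMonotone_of_pairWeight hk le_rfl h0 (Y := Y) fun z => ?_
  obtain ⟨i, σ⟩ := z
  rw [pairedPerturbation, PMF.ofFintype_apply,
    ENNReal.toReal_ofReal (pairedWeight_nonneg h0.le h1 Y _)]
  rcases Int.units_eq_one_or σ with rfl | rfl
  · have e : 2 * (i : ℕ) / 2 = i := by omega
    simp only [pairedWeight, pairIndex, pairWeight, if_pos, add_zero, e, pow_mul, sgn]
    simp
    ring
  · have e : (2 * (i : ℕ) + 1) / 2 = i := by omega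
    simp only [pairedWeight, pairIndex, pairWeight, if_neg (show ¬ ((-1 : ℤˣ) = 1) by decide), e,
      pow_add, pow_mul, sgn]
    simp
    ring

/-! ### From testers to energies of memory contents. -/

/-- The paired perturbation as a distribution on signed pairs. -/
noncomputable def signedPairDist {k : ℕ} (hk : 0 < k) {ε : ℝ} (h0 : 0 ≤ ε) (h1 : ε ≤ 1)
    (Y : Fin k → ℤˣ) : PMF (Fin k × ℤˣ) :=
  PMF.ofFintype (fun z => ENNReal.ofReal (pairWeight ε Y z)) (by
    rw [← ENNReal.ofReal_sum_of_nonneg fun z _ => pairWeight_nonneg h0 h1 z, sum_pairWeight hk,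
      ENNReal.ofReal_one])

/-- The paired perturbation as a distribution on a domain of at least `2 * k` points. -/
noncomputable def paddedDist {k n : ℕ} (hk : 0 < k) (h : 2 * k ≤ n) {ε : ℝ} (h0 : 0 ≤ ε)
    (h1 : ε ≤ 1) (Y : Fin k → ℤˣ) : PMF (Fin n) :=
  (signedPairDist hk h0 h1 Y).map (pairIndex h)

theorem paddedDist_pairIndex {k n : ℕ} (hk : 0 < k) (h : 2 * k ≤ n) {ε : ℝ} (h0 : 0 ≤ ε)
    (h1 : ε ≤ 1) (Y : Fin k → ℤˣ) (z : Fin k × ℤˣ) :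
    paddedDist hk h h0 h1 Y (pairIndex h z) = ENNReal.ofReal (pairWeight ε Y z) := by
  rw [paddedDist, PMF.map_apply, tsum_fintype]
  simp [(pairIndex_injective h).eq_iff, signedPairDist]

theorem toReal_paddedDist_pairIndex {k n : ℕ} (hk : 0 < k) (h : 2 * k ≤ n) {ε : ℝ} (h0 : 0 ≤ ε)
    (h1 : ε ≤ 1) (Y : Fin k → ℤˣ) (z : Fin k × ℤˣ) :
    (paddedDist hk h h0 h1 Y (pairIndex h z)).toReal = pairWeight ε Y z := by
  rw [paddedDist_pairIndex, ENNReal.toReal_ofReal (pairWeight_nonneg h0 h1 z)]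

theorem isMonotoneDist_paddedDist_zero {k n : ℕ} (hk : 0 < k) (h : 2 * k ≤ n) (Y : Fin k → ℤˣ) :
    IsMonotoneDist (paddedDist hk h le_rfl zero_le_one Y) := by
  have hlt : ∀ i : Fin n, (i : ℕ) < 2 * k → paddedDist hk h le_rfl zero_le_one Y i =
      ENNReal.ofReal (1 / (2 * k)) := by
    intro i hi
    obtain ⟨z, rfl⟩ : ∃ z, pairIndex h z = i := by
      rcases Nat.even_or_odd' (i : ℕ) with ⟨c, hc | hc⟩
      · exact ⟨(⟨c, by omega⟩, 1), Fin.ext (by simp [pairIndex, hc])⟩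
      · exact ⟨(⟨c, by omega⟩, -1), Fin.ext (by simp [pairIndex, hc])⟩
    rw [paddedDist_pairIndex, pairWeight, zero_mul, zero_mul, add_zero]
  have hge : ∀ i : Fin n, ¬ (i : ℕ) < 2 * k → paddedDist hk h le_rfl zero_le_one Y i = 0 := by
    intro i hi
    rw [paddedDist, PMF.map_apply, tsum_fintype]
    refine Finset.sum_eq_zero fun z _ => if_neg ?_
    rintro rfl
    apply hi
    have := z.1.isLt
    simp only [pairIndex]
    split_ifs <;> omega
  intro i j hij
  by_cases hj : (j : ℕ) < 2 * k
  · rw [hlt j hj, hlt i (lt_of_le_of_lt hij hj)]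
  · rw [hge j hj]
    simp

theorem map_run_iidStream_map {n m S : ℕ} {X : Type*} [Fintype X] (a : DetStreamingAlgorithm n m S)
    (p : PMF X) (φ : X → Fin n) :
    ((iidStream (p.map φ) S).map a.run) true =
      ∑ z : Fin S → X, if a.run (fun j => φ (z j)) = true then ∏ j, p (z j) else 0 := by
  have hx : ∀ x : Fin S → Fin n, iidStream (p.map φ) S x =
      ∑ z : Fin S → X, if x = fun j => φ (z j) then ∏ j, p (z j) else 0 := by
    intro x
    rw [iidStream, PMF.ofFintype_apply]
    simp only [PMF.map_apply, tsum_fintype]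
    have e := Finset.prod_univ_sum (fun _ : Fin S => (Finset.univ : Finset X))
      (fun j z => if x j = φ z then p z else 0)
    rw [Fintype.piFinset_univ] at e
    refine Eq.trans (Finset.prod_congr rfl fun j _ => Finset.sum_congr rfl fun z _ => ?_) (e.trans
      (Finset.sum_congr rfl fun z _ => ?_))
    · congr
    · rw [Finset.prod_ite_zero]
      simp only [Finset.mem_univ, true_imp_iff, funext_iff]
  rw [PMF.map_apply, tsum_fintype]
  simp only [hx]
  have e2 : ∀ x : Fin S → Fin n,
      (if true = a.run x then
        ∑ z : Fin S → X, if x = fun j => φ (z j) then ∏ j, p (z j) else 0 else 0) =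
      ∑ z : Fin S → X, if x = fun j => φ (z j) then
        (if a.run (fun j => φ (z j)) = true then ∏ j, p (z j) else 0) else 0 := by
    intro x
    by_cases hr : true = a.run x
    · rw [if_pos hr]
      refine Finset.sum_congr rfl fun z _ => ?_
      by_cases hz : x = fun j => φ (z j)
      · rw [if_pos hz, if_pos hz, ← hz, if_pos hr.symm]
      · rw [if_neg hz, if_neg hz]
    · rw [if_neg hr]
      refine (Finset.sum_eq_zero fun z _ => ?_).symm
      by_cases hz : x = fun j => φ (z j)
      · rw [if_pos hz, ← hz, if_neg fun h => hr h.symm]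
      · rw [if_neg hz]
  simp only [e2]
  rw [Finset.sum_comm]
  simp

/-- The memory after `t` samples, as a function of the samples. -/
def DetStreamingAlgorithm.memoryAt {n m S : ℕ} {X : Type*} (a : DetStreamingAlgorithm n m S)
    (φ : X → Fin n) (t : ℕ) (z : Fin t → X) : Memory m :=
  -- Past the end of the stream the memory stays as it is, so that it is defined for every `t`.
  Fin.foldl t (fun s j => if h : (j : ℕ) < S then a.step ⟨j, h⟩ s (φ (z j)) else s) a.init

theorem DetStreamingAlgorithm.memoryAt_succ {n m S : ℕ} {X : Type*}
    (a : DetStreamingAlgorithm n m S) (φ : X → Fin n) (t : ℕ) (z : Fin (t + 1) → X) :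
    a.memoryAt φ (t + 1) z =
      (fun (t : ℕ) s x => if h : t < S then a.step ⟨t, h⟩ s (φ x) else s) t
        (a.memoryAt φ t (Fin.init z)) (z (Fin.last t)) := by
  rw [memoryAt, Fin.foldl_succ_last]
  rfl

theorem DetStreamingAlgorithm.run_eq_verdict_memoryAt {n m S : ℕ} {X : Type*}
    (a : DetStreamingAlgorithm n m S) (φ : X → Fin n) (z : Fin S → X) :
    a.run (fun j => φ (z j)) = a.verdict (a.memoryAt φ S z) := by
  simp [run, finalMemory, memoryAt]

/-- The acceptance probability of a deterministic algorithm on a paired perturbation. -/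
theorem map_run_iidStream_paddedDist {k n m S : ℕ} (a : DetStreamingAlgorithm n m S)
    (hk : 0 < k) (h : 2 * k ≤ n) {ε : ℝ} (h0 : 0 ≤ ε) (h1 : ε ≤ 1) (Y : Fin k → ℤˣ) :
    ((iidStream (paddedDist hk h h0 h1 Y) S).map a.run) true = ENNReal.ofReal
      (∑ z : Fin S → Fin k × ℤˣ with a.verdict (a.memoryAt (pairIndex h) S z) = true,
        streamWeight ε Y z) := by
  rw [paddedDist, map_run_iidStream_map,
    ENNReal.ofReal_sum_of_nonneg fun z _ => streamWeight_nonneg h0 h1 z, Finset.sum_filter]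
  refine Finset.sum_congr rfl fun z _ => ?_
  rw [a.run_eq_verdict_memoryAt, streamWeight,
    ENNReal.ofReal_prod_of_nonneg fun j _ => pairWeight_nonneg h0 h1 _]
  rfl

theorem sum_verdict_stateMass {k t : ℕ} {M : Type*} [Fintype M] [DecidableEq M] (ε : ℝ)
    (w : (Fin k → ℤˣ) → ℝ) (F : (Fin t → Fin k × ℤˣ) → M) (v : M → Bool) :
    ∑ μ with v μ = true, stateMass ε w F μ =
      ∑ Y, w Y * ∑ z with v (F z) = true, streamWeight ε Y z := by
  simp only [stateMass]
  rw [Finset.sum_comm]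
  refine Finset.sum_congr rfl fun Y _ => ?_
  rw [Finset.mul_sum, Finset.sum_filter, Finset.sum_filter,
    ← Finset.sum_fiberwise Finset.univ F
      (fun z => if v (F z) = true then w Y * streamWeight ε Y z else 0)]
  refine Finset.sum_congr rfl fun μ _ => ?_
  split_ifs with h
  · refine Finset.sum_congr rfl fun z hz => ?_
    rw [(Finset.mem_filter.1 hz).2, if_pos h]
  · refine (Finset.sum_eq_zero fun z hz => ?_).symm
    rw [(Finset.mem_filter.1 hz).2, if_neg h]

/-- A bound on the energies of all memory contents bounds the advantage of a deterministic
algorithm. -/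
theorem accept_uniform_le {k n m S : ℕ} (a : DetStreamingAlgorithm n m S)
    (hk : 0 < k) (h : 2 * k ≤ n) {ε : ℝ} (h0 : 0 ≤ ε) (h1 : ε ≤ 1) {w : (Fin k → ℤˣ) → ℝ}
    (hw : ∀ Y, 0 ≤ w Y) (hw1 : ∑ Y, w Y = 1) {E : ℝ}
    (hE : ∀ t < S, ∀ F : (Fin t → Fin k × ℤˣ) → Memory m, signEnergy ε w F ≤ E) :
    ∑ z : Fin S → Fin k × ℤˣ with a.verdict (a.memoryAt (pairIndex h) S z) = true,
        streamWeight 0 1 z ≤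
      ∑ Y, w Y * ∑ z : Fin S → Fin k × ℤˣ with a.verdict (a.memoryAt (pairIndex h) S z) = true,
        streamWeight ε Y z + √(4 * (S * (ε ^ 2 / k * E))) := by
  have hKL := stateKL_le hk h0 h1 hw (a.memoryAt (pairIndex h))
    (fun t s x => if h' : t < S then a.step ⟨t, h'⟩ s (pairIndex h x) else s)
    (a.memoryAt_succ (pairIndex h)) S
  have hKL2 : stateKL ε w (a.memoryAt (pairIndex h) S) ≤ S * (ε ^ 2 / k * E) := by
    refine hKL.trans ?_
    have := Finset.sum_le_sum fun t (ht : t ∈ Finset.range S) =>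
      hE t (Finset.mem_range.1 ht) (a.memoryAt (pairIndex h) t)
    rw [Finset.sum_const, Finset.card_range, nsmul_eq_mul] at this
    have := mul_le_mul_of_nonneg_left this (by positivity : 0 ≤ ε ^ 2 / k)
    linarith
  have hP := sq_sub_le_four_mul_kl (stateMass 0 w (a.memoryAt (pairIndex h) S))
    (stateMass ε w (a.memoryAt (pairIndex h) S))
    (stateMass_nonneg le_rfl zero_le_one hw _) (stateMass_nonneg h0 h1 hw _)
    (stateMass_eq_zero h0 h1 hw _) (sum_stateMass hk hw1 _) (sum_stateMass hk hw1 _)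
    (Finset.univ.filter fun μ => a.verdict μ = true)
  rw [sum_verdict_stateMass, sum_verdict_stateMass] at hP
  have hunif : ∀ (Y : Fin k → ℤˣ) (z : Fin S → Fin k × ℤˣ),
      streamWeight 0 Y z = streamWeight 0 1 z := by
    intro Y z
    simp [streamWeight, pairWeight]
  simp only [hunif] at hP
  rw [← Finset.sum_mul, hw1, one_mul] at hP
  have := Real.abs_le_sqrt (hP.trans (mul_le_mul_of_nonneg_left hKL2 (by norm_num)))
  linarith [(abs_le.1 this).2]

/-- The lower bound in terms of the energies of the memory contents. -/
theorem TestsMonotonicity.le_mul_energy {k n m S : ℕ} {A : StreamingAlgorithm n m S} {δ : ℝ}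
    (hA : TestsMonotonicity A δ) (hk : 0 < k) (h : 2 * k ≤ n) {ε : ℝ} (h0 : 0 ≤ ε) (h1 : ε ≤ 1)
    {w : (Fin k → ℤˣ) → ℝ} (hw : ∀ Y, 0 ≤ w Y) (hw1 : ∑ Y, w Y = 1)
    (hfar : ∀ Y, w Y ≠ 0 → FarFromMonotone δ (paddedDist hk h h0 h1 Y)) {E : ℝ}
    (hE : ∀ t < S, ∀ F : (Fin t → Fin k × ℤˣ) → Memory m, signEnergy ε w F ≤ E) :
    1 / 36 ≤ S * (ε ^ 2 / k * E) := by
  obtain ⟨c, hc⟩ : ∃ c, c = √(4 * (S * (ε ^ 2 / k * E))) := ⟨_, rfl⟩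
  have hc0 : 0 ≤ c := hc ▸ Real.sqrt_nonneg _
  -- The deterministic bound is averaged over the random choice of the algorithm; the additive error
  -- `c` is the same for all of them.
  have hacc : A.outputLaw (paddedDist hk h le_rfl zero_le_one 1) true ≤
      ∑ Y, ENNReal.ofReal (w Y) * A.outputLaw (paddedDist hk h h0 h1 Y) true +
        ENNReal.ofReal c := by
    simp only [StreamingAlgorithm.outputLaw, PMF.bind_apply, ← ENNReal.tsum_mul_left]
    rw [← Summable.tsum_finsetSum fun _ _ => ENNReal.summable]
    have e : ENNReal.ofReal c = ∑' a, A a * ENNReal.ofReal c := by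
      rw [ENNReal.tsum_mul_right, A.tsum_coe, one_mul]
    rw [e, ← ENNReal.tsum_add]
    refine ENNReal.tsum_le_tsum fun a => ?_
    simp only [mul_left_comm _ (A a)]
    rw [← Finset.mul_sum, ← mul_add]
    refine mul_le_mul_right ?_ _
    simp only [map_run_iidStream_paddedDist]
    have hn : ∀ Y, 0 ≤ ∑ z : Fin S → Fin k × ℤˣ with
        a.verdict (a.memoryAt (pairIndex h) S z) = true, streamWeight ε Y z :=
      fun Y => Finset.sum_nonneg fun z _ => streamWeight_nonneg h0 h1 z
    simp only [← ENNReal.ofReal_mul (hw _)]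
    rw [← ENNReal.ofReal_sum_of_nonneg fun Y _ => mul_nonneg (hw Y) (hn Y),
      ← ENNReal.ofReal_add (Finset.sum_nonneg fun Y _ => mul_nonneg (hw Y) (hn Y))
        hc0, hc]
    exact ENNReal.ofReal_le_ofReal (accept_uniform_le a hk h h0 h1 hw hw1 hE)
  have hrej : ∀ Y, ENNReal.ofReal (w Y) * A.outputLaw (paddedDist hk h h0 h1 Y) true ≤
      ENNReal.ofReal (w Y * (1 / 3)) := by
    intro Y
    by_cases hY : w Y = 0
    · simp [hY]
    rw [ENNReal.ofReal_mul (hw Y)]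
    refine mul_le_mul_right ?_ _
    have hf := hA.2 _ (hfar Y hY)
    set L := A.outputLaw (paddedDist hk h h0 h1 Y)
    have hs : L true + L false = 1 := by
      have := L.tsum_coe
      rwa [tsum_fintype, Fintype.sum_bool] at this
    rw [← ENNReal.ofReal_toReal (L.apply_ne_top true)]
    refine ENNReal.ofReal_le_ofReal ?_
    have hs' := congrArg ENNReal.toReal hs
    rw [ENNReal.toReal_add (L.apply_ne_top _) (L.apply_ne_top _), ENNReal.toReal_one] at hs'
    have hf' := ENNReal.toReal_mono (L.apply_ne_top _) hf
    rw [ENNReal.toReal_div] at hf'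
    norm_num at hf'
    linarith
  have hu := hA.1 _ (isMonotoneDist_paddedDist_zero hk h 1)
  have h3 := (hu.trans hacc).trans (add_le_add_left (Finset.sum_le_sum fun Y _ => hrej Y) _)
  rw [← ENNReal.ofReal_sum_of_nonneg fun Y _ => mul_nonneg (hw Y) (by norm_num),
    ← Finset.sum_mul, hw1, one_mul, ← ENNReal.ofReal_add (by norm_num) hc0] at h3
  have h4 := ENNReal.toReal_mono ENNReal.ofReal_ne_top h3
  rw [ENNReal.toReal_ofReal (add_nonneg (by norm_num) hc0),
    ENNReal.toReal_div] at h4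
  norm_num at h4
  -- Acceptance `2/3` on uniform against `1/3` on the mixture; squaring `1/3` and dividing by `4`
  -- gives `1/36`.
  have h5 : (1 / 3 : ℝ) ≤ c := by linarith
  rw [hc, Real.le_sqrt' (by norm_num)] at h5
  linarith

/-! ### Choice of parameters and the final bounds. -/

theorem log_card_memory_le (m : ℕ) : Real.log (Fintype.card (Memory m)) ≤ m := by
  have h : Fintype.card (Memory m) = 2 ^ m := by simp [Memory]
  rw [h, Nat.cast_pow, Real.log_pow]
  refine mul_le_of_le_one_right (by positivity) ?_
  have := Real.log_two_lt_d9
  push_cast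
  linarith

theorem three_le_div_two_and_le {n : ℕ} (hn : 6 ≤ n) :
    3 ≤ n / 2 ∧ 2 * (n / 2) ≤ n ∧ (n : ℝ) / 3 ≤ ((n / 2 : ℕ) : ℝ) ∧
      2 * ((n / 2 : ℕ) : ℝ) ≤ n := by
  refine ⟨by omega, by omega, ?_, ?_⟩
  · have : n ≤ 3 * (n / 2) := by omega
    have : (n : ℝ) ≤ 3 * ((n / 2 : ℕ) : ℝ) := by exact_mod_cast this
    linarith
  · have : 2 * (n / 2) ≤ n := by omega
    exact_mod_cast this

/-- The lower bound for uniformly random signs. -/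
theorem TestsMonotonicity.le_mul_uniform_energy {k n m S : ℕ} {A : StreamingAlgorithm n m S}
    {ε : ℝ} (hA : TestsMonotonicity A (ε / 4)) (hk : 3 ≤ k) (h : 2 * k ≤ n) (h0 : 0 < ε)
    (h1 : ε ≤ 1) {E : ℝ}
    (hE : ∀ t < S, ∀ F : (Fin t → Fin k × ℤˣ) → Memory m,
      signEnergy ε (fun _ => (1 / 2) ^ k) F ≤ E) :
    1 / 36 ≤ S * (ε ^ 2 / k * E) :=
  hA.le_mul_energy (by omega) h h0.le h1 (fun _ => by positivity) (sum_signs_const k)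
    (fun Y _ => farFromMonotone_of_pairWeight hk h h0 fun z =>
      toReal_paddedDist_pairIndex _ h h0.le h1 Y z) hE

/-- Energy `2 * m` and `k ≥ n / 3` give the constant `1 / (36 * 2 * 3)`. -/
theorem TestsMonotonicity.mul_ge_of_large {n m S : ℕ} {A : StreamingAlgorithm n m S}
    {ε : ℝ} (hA : TestsMonotonicity A (ε / 4)) (hn : 6 ≤ n) (h0 : 0 < ε) (h1 : ε ≤ 1) :
    1 / 216 * ((n : ℝ) / ε ^ 2) ≤ S * m := by
  obtain ⟨hk, hkn, hk3, -⟩ := three_le_div_two_and_le hn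
  set k := n / 2
  have hkR : (0 : ℝ) < k := by exact_mod_cast (by omega : 0 < k)
  have h := hA.le_mul_uniform_energy hk hkn h0 h1 (E := 2 * m) fun t _ F =>
    (signEnergy_le_log_card (by omega) h0.le h1 F).trans
      (mul_le_mul_of_nonneg_left (log_card_memory_le m) (by norm_num))
  have e : (S : ℝ) * (ε ^ 2 / k * (2 * m)) = 2 * ε ^ 2 * (S * m) / k := by ring
  rw [e, le_div_iff₀ hkR] at h
  rw [← mul_div_assoc, div_le_iff₀ (by positivity)]
  linarith

/-- With no memory the verdict ignores the stream, and accepting and rejecting would both have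
probability at least `2/3`. -/
theorem TestsMonotonicity.memory_pos {n m S : ℕ} {A : StreamingAlgorithm n m S} {δ : ℝ}
    (hA : TestsMonotonicity A δ) {D D' : PMF (Fin n)} (hD : IsMonotoneDist D)
    (hD' : FarFromMonotone δ D') : 0 < m := by
  rcases Nat.eq_zero_or_pos m with rfl | hm
  · exfalso
    have hlaw : A.outputLaw D = A.outputLaw D' := by
      have hrun : ∀ a : DetStreamingAlgorithm n 0 S,
          a.run = Function.const _ (a.verdict a.init) := by
        intro a
        funext x
        rw [DetStreamingAlgorithm.run, Function.const_apply]
        exact congrArg _ (Subsingleton.elim _ _)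
      simp only [StreamingAlgorithm.outputLaw, hrun, PMF.map_const]
    have ht := hA.1 D hD
    have hf := hA.2 D' hD'
    rw [hlaw] at ht
    set L := A.outputLaw D'
    have hs : L true + L false = 1 := by
      have := L.tsum_coe
      rwa [tsum_fintype, Fintype.sum_bool] at this
    have h := add_le_add ht hf
    rw [hs] at h
    have h' := ENNReal.toReal_mono ENNReal.one_ne_top h
    have htop : (2 / 3 : ENNReal) ≠ ⊤ := ENNReal.div_ne_top (by norm_num) (by norm_num)
    rw [ENNReal.toReal_add htop htop, ENNReal.toReal_div] at h'
    norm_num at h'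
  · exact hm

/-- A single pair with the deterministic sign `-1` suffices: its energy is at most `1`, so `S * ε² ≥
1/36`, and `m ≥ 1`. -/
theorem TestsMonotonicity.mul_ge_of_small {n m S : ℕ} {A : StreamingAlgorithm n m S}
    {ε : ℝ} (hA : TestsMonotonicity A (ε / 4)) (hn : 2 ≤ n) (hn' : n < 6) (h0 : 0 < ε)
    (h1 : ε ≤ 1) : 1 / 216 * ((n : ℝ) / ε ^ 2) ≤ S * m := by
  have hfar : FarFromMonotone (ε / 4) (paddedDist one_pos hn h0.le h1 (-1)) :=
    farFromMonotone_of_forall_neg one_pos hn h0 (Y := -1)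
      (fun i => by rw [Pi.neg_apply, Pi.one_apply]; decide)
      fun z => toReal_paddedDist_pairIndex _ hn h0.le h1 _ z
  have hm := hA.memory_pos (isMonotoneDist_paddedDist_zero one_pos hn 1) hfar
  have hw : ∀ Y, 0 ≤ (Pi.single (-1) 1 : (Fin 1 → ℤˣ) → ℝ) Y := fun Y => by
    rw [Pi.single_apply]; split_ifs <;> norm_num
  have hw1 : ∑ Y, (Pi.single (-1) 1 : (Fin 1 → ℤˣ) → ℝ) Y = 1 := by simp
  have h := hA.le_mul_energy one_pos hn h0.le h1 hw hw1
    (fun Y hY => by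
      rw [Pi.single_apply] at hY
      have : Y = -1 := by by_contra hne; exact hY (if_neg hne)
      rw [this]
      exact hfar)
    (fun t _ F => signEnergy_le_card one_pos h0.le h1 hw hw1 F)
  simp only [Nat.cast_one, div_one, mul_one] at h
  have hmR : (1 : ℝ) ≤ m := by exact_mod_cast hm
  have hnR : (n : ℝ) ≤ 6 := by exact_mod_cast hn'.le
  have hSm : (S : ℝ) ≤ S * m := le_mul_of_one_le_right (by positivity) hmR
  rw [← mul_div_assoc, div_le_iff₀ (by positivity)]
  have := mul_le_mul_of_nonneg_right hSm (by positivity : 0 ≤ ε ^ 2)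
  linarith

theorem TestsMonotonicity.mul_ge {n m S : ℕ} {A : StreamingAlgorithm n m S}
    {ε : ℝ} (hA : TestsMonotonicity A (ε / 4)) (hn : 2 ≤ n) (h0 : 0 < ε) (h1 : ε ≤ 1) :
    1 / 216 * ((n : ℝ) / ε ^ 2) ≤ S * m := by
  rcases lt_or_ge n 6 with h | h
  · exact hA.mul_ge_of_small hn h h0 h1
  · exact hA.mul_ge_of_large h h0 h1

/-- The energy bound for streams of at most `n ^ 0.9 * log n / 60` samples, with `x = n ^ 0.05`. -/
theorem signEnergy_le_div_log {k n m t : ℕ} (hk : 3 ≤ k) (hk3 : (n : ℝ) / 3 ≤ k)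
    (hk2 : 2 * (k : ℝ) ≤ n) {ε x : ℝ} (h0 : 0 < ε) (h1 : ε ≤ 1)
    (hn : 1 ≤ Real.log n) (hx : x = Real.exp (Real.log n / 20)) (hm : x ^ 2 / ε ^ 4 ≤ m)
    (ht : (t : ℝ) ≤ 1 / 60 * (x ^ 18 * Real.log n)) (F : (Fin t → Fin k × ℤˣ) → Memory m) :
    signEnergy ε (fun _ => (1 / 2) ^ k) F ≤ 64030 * ε ^ 2 * m / Real.log n := by
  set l := Real.log n with hl
  have hkR : (0 : ℝ) < k := by exact_mod_cast (by omega : 0 < k)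
  have hnR : (0 : ℝ) < n := by linarith
  have hx1 : 1 ≤ x := by rw [hx]; exact Real.one_le_exp (by positivity)
  have hx20 : x ^ 20 = n := by
    rw [hx, ← Real.exp_nat_mul, ← Real.exp_log hnR, ← hl]
    congr 1
    push_cast
    ring
  have hx0 : 0 < x := by linarith
  have hlx : l ≤ 20 * x := by
    have := Real.add_one_le_exp (l / 20)
    rw [← hx] at this
    linarith
  have htk : (t : ℝ) / k * x ≤ 1 := by
    rw [div_mul_eq_mul_div, div_le_one hkR]
    calc (t : ℝ) * x ≤ 1 / 60 * (x ^ 18 * (20 * x)) * x := by gcongr; exact ht.trans (by gcongr)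
      _ = x ^ 20 / 3 := by ring
      _ ≤ k := by rw [hx20]; exact hk3
  -- The load cutoff is `20`, and `16000 = 40 * 20²` makes `θ * (20 * ε)²` equal to `l / 40`, so
  -- that its exponential is only `√x`.
  set θ : ℝ := l / (16000 * ε ^ 2) with hθ
  have hθ0 : 0 < θ := by positivity
  have hθB : θ * (ε * (20 : ℕ)) ^ 2 = l / 40 := by
    rw [hθ]; push_cast; field_simp; norm_num
  have hsparse : (t : ℝ) / k * ((θ * (ε * (20 : ℕ))) ^ 2 / 2 *
      Real.exp (θ * (ε * (20 : ℕ)) ^ 2)) ≤ θ / 2 := by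
    have e : (θ * (ε * (20 : ℕ))) ^ 2 = θ * (l / 40) := by rw [← hθB]; ring
    rw [e, hθB]
    have h2 : l / 40 * Real.exp (l / 40) ≤ x := by
      have h3 : l / 40 ≤ Real.exp (l / 40) := by linarith [Real.add_one_le_exp (l / 40)]
      calc _ ≤ Real.exp (l / 40) * Real.exp (l / 40) := by gcongr
        _ = x := by rw [hx, ← Real.exp_add]; congr 1; ring
    calc (t : ℝ) / k * (θ * (l / 40) / 2 * Real.exp (l / 40))
        = θ / 2 * (t / k * (l / 40 * Real.exp (l / 40))) := by ring
      _ ≤ θ / 2 * (t / k * x) := by gcongr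
      _ ≤ θ / 2 * 1 := by gcongr
      _ = θ / 2 := mul_one _
  have h := signEnergy_le_of_sparse (by omega) h0.le h1 20 hθ0 hx1 hsparse F
  refine h.trans ?_
  have a1 : 4 / θ * Real.log (Fintype.card (Memory m)) ≤ 64000 * ε ^ 2 * m / l := by
    calc _ ≤ 4 / θ * m := by gcongr; exact log_card_memory_le m
      _ = _ := by rw [hθ]; field_simp; ring
  -- Cutoff `20` and `x = n ^ (1/20)` make the tail factor exactly `1 / n`, which cancels the number
  -- of pairs.
  have a2 : 2 * k * (x⁻¹ ^ 20 * Real.exp (t / k * x)) ≤ 3 := by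
    rw [inv_pow, hx20]
    calc 2 * k * ((n : ℝ)⁻¹ * Real.exp (t / k * x)) ≤ n * ((n : ℝ)⁻¹ * Real.exp 1) := by gcongr
      _ = Real.exp 1 := by field_simp
      _ ≤ 3 := by linarith [Real.exp_one_lt_d9]
  -- The constant tail is absorbed into the main term, since `l ≤ 10 * x²` and `m ≥ x² / ε⁴`.
  have a3 : 3 ≤ 30 * ε ^ 2 * m / l := by
    rw [le_div_iff₀ (by positivity)]
    rw [div_le_iff₀ (by positivity)] at hm
    have b1 : l ≤ 10 * x ^ 2 := by
      have := Real.add_one_le_exp (l / 10)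
      have e : Real.exp (l / 10) = x ^ 2 := by
        rw [hx, ← Real.exp_nat_mul]; congr 1; push_cast; ring
      rw [e] at this
      linarith
    have b2 : ε ^ 4 ≤ ε ^ 2 := pow_le_pow_of_le_one h0.le h1 (by norm_num)
    have b3 := mul_le_mul_of_nonneg_left b2 (by positivity : (0 : ℝ) ≤ m)
    linarith
  have e : 64030 * ε ^ 2 * m / l = 64000 * ε ^ 2 * m / l + 30 * ε ^ 2 * m / l := by ring
  linarith

theorem TestsMonotonicity.mul_ge_log {n m S : ℕ} {A : StreamingAlgorithm n m S}
    {ε : ℝ} (hA : TestsMonotonicity A (ε / 4)) (hn : 2 ≤ n) (h0 : 0 < ε) (h1 : ε ≤ 1)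
    (hm : (n : ℝ) ^ (0.1 : ℝ) / ε ^ 4 ≤ m) :
    1 / 7000000 * ((n : ℝ) * Real.log n / ε ^ 4) ≤ S * m := by
  set l := Real.log n with hl
  have hn2 : (2 : ℝ) ≤ n := by exact_mod_cast hn
  have hnR : (0 : ℝ) < n := by linarith
  have hl0 : 0 < l := Real.log_pos (by linarith)
  obtain ⟨x, hx⟩ : ∃ x, x = Real.exp (l / 20) := ⟨_, rfl⟩
  have hx1 : 1 ≤ x := by rw [hx]; exact Real.one_le_exp (by positivity)
  have hx20 : x ^ 20 = n := by
    rw [hx, ← Real.exp_nat_mul, ← Real.exp_log hnR, ← hl]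
    congr 1
    push_cast
    ring
  have hx2 : x ^ 2 = (n : ℝ) ^ (0.1 : ℝ) := by
    rw [hx, ← Real.exp_nat_mul, Real.rpow_def_of_pos hnR, ← hl]
    congr 1
    push_cast
    ring
  rw [← hx2] at hm
  -- Long streams need no argument: `x ^ 18 * x ^ 2 = n`. Otherwise every prefix satisfies the
  -- short-stream energy bound.
  rcases le_or_gt (1 / 60 * (x ^ 18 * l)) (S : ℝ) with hS | hS
  · calc 1 / 7000000 * ((n : ℝ) * l / ε ^ 4) ≤ 1 / 60 * ((n : ℝ) * l / ε ^ 4) := by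
          gcongr; norm_num
      _ = 1 / 60 * (x ^ 18 * l) * (x ^ 2 / ε ^ 4) := by rw [← hx20]; ring
      _ ≤ S * m := by gcongr
  have hbase := hA.mul_ge hn h0 h1
  rcases lt_or_ge n 6 with h6 | h6
  · have hS1 : (1 : ℝ) ≤ S := by
      have hS0 : S ≠ 0 := by
        rintro rfl
        rw [Nat.cast_zero, zero_mul] at hbase
        have : 0 < 1 / 216 * ((n : ℝ) / ε ^ 2) := by positivity
        linarith
      exact_mod_cast Nat.one_le_iff_ne_zero.2 hS0
    have hn6 : (n : ℝ) ≤ 6 := by exact_mod_cast h6.le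
    have hl6 : l ≤ 6 := by linarith [Real.log_le_sub_one_of_pos hnR]
    calc 1 / 7000000 * ((n : ℝ) * l / ε ^ 4) ≤ 1 / 7000000 * (6 * 6 / ε ^ 4) := by gcongr
      _ ≤ 1 * (1 ^ 2 / ε ^ 4) := by
          rw [← mul_div_assoc, ← mul_div_assoc]
          exact div_le_div_of_nonneg_right (by norm_num) (by positivity)
      _ ≤ 1 * (x ^ 2 / ε ^ 4) := by gcongr
      _ ≤ S * m := by gcongr
  obtain ⟨hk, hkn, hk3, hk2⟩ := three_le_div_two_and_le h6
  set k := n / 2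
  have hkR : (0 : ℝ) < k := by exact_mod_cast (by omega : 0 < k)
  have hl1 : 1 ≤ l := by
    rw [hl, Real.le_log_iff_exp_le hnR]
    have : (6 : ℝ) ≤ n := by exact_mod_cast h6
    linarith [Real.exp_one_lt_d9]
  have h := hA.le_mul_uniform_energy hk hkn h0 h1 (E := 64030 * ε ^ 2 * m / l) fun t ht F =>
    signEnergy_le_div_log hk hk3 hk2 h0 h1 hl1 hx hm
      (le_trans (by exact_mod_cast ht.le) hS.le) F
  have e : (S : ℝ) * (ε ^ 2 / k * (64030 * ε ^ 2 * m / l)) =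
      64030 * ε ^ 4 * (S * m) / (k * l) := by field_simp
  rw [e, le_div_iff₀ (by positivity)] at h
  rw [← mul_div_assoc, div_le_iff₀ (by positivity)]
  -- The constants fit because `36 * 3 * 64030 < 7000000`.
  have hkl := mul_le_mul_of_nonneg_right hk3 hl0.le
  have hpos : 0 ≤ (S : ℝ) * m * ε ^ 4 := by positivity
  linarith

theorem mainTheorem3 :
    (∀ (k : ℕ) (ε : ℝ) (hk : 3 ≤ k) (hε0 : 0 < ε) (hε1 : ε ≤ 1) (Y : Fin k → ℤˣ),
      FarFromMonotone (ε / 4)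
        (pairedPerturbation (Nat.lt_of_lt_of_le (Nat.succ_pos 2) hk) hε0.le hε1 Y)) ∧
    ∃ c : ℝ, 0 < c ∧
      ∀ (n m S : ℕ) (ε : ℝ), 2 ≤ n → 0 < ε → ε ≤ 1 →
        ∀ A : StreamingAlgorithm n m S, TestsMonotonicity A (ε / 4) →
          c * ((n : ℝ) / ε ^ 2) ≤ (S : ℝ) * (m : ℝ) ∧
          ((n : ℝ) ^ (0.34 : ℝ) / ε ^ (8 / 3 : ℝ) + (n : ℝ) ^ (0.1 : ℝ) / ε ^ 4 ≤ (m : ℝ) →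
            (m : ℝ) ≤ Real.sqrt (n : ℝ) / ε ^ 3 →
            c * ((n : ℝ) * Real.log (n : ℝ) / ε ^ 4) ≤ (S : ℝ) * (m : ℝ)) := by
  refine ⟨fun k ε hk hε0 hε1 Y => pairedPerturbation_farFromMonotone hk hε0 hε1 _ Y,
    1 / 7000000, by norm_num, fun n m S ε hn h0 h1 A hA => ⟨?_, fun hm _ => ?_⟩⟩
  · refine le_trans ?_ (hA.mul_ge hn h0 h1)
    gcongr
    norm_num
  · refine hA.mul_ge_log hn h0 h1 (le_trans ?_ hm)
    exact le_add_of_nonneg_left (by positivity)
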